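/- Let $I\subset\mathbb{R}$ be a bounded non-empty open interval and let $0<a_1\le a_2$, $0<b_1\le b_2$. For $0<c\le C$ let $\mathcal{M}(c,C)$ be the set of measurable $f$ with $c\le f\le C$ a.e. in $I$. Given $a^\epsilon\in\mathcal{M}(a_1,a_2)$, a test sequence for $a^\epsilon$ is a sequence $u^\epsilon\rightharpoonup u$ weakly in $H^1(I)$ such that $-(a^\epsilon (u^\epsilon)')'$ converges strongly in $H^{-1}(I)$. We say that $a^\epsilon$ $H$-converges to $a^*\in\mathcal{M}(a_1,a_2)$ if $a^\epsilon (u^\epsilon)'\rightharpoonup a^*u'$ weakly in $L^2(I)$ for all test sequences (along $a^\epsilon$ or any subsequence of it). For such $a^\epsilon$, we say that $b^\epsilon\in\mathcal{M}(b_1,b_2)$ converges to $b^{\#}\in L^\infty(I)$ relative to $a^\epsilon$ if $b^\epsilon((u^\epsilon)')^2\rightharpoonup b^{\#}(u')^2$ in $\mathcal{D}'(I)$ for all test sequences $u^\epsilon\rightharpoonup u$ for $a^\epsilon$. (1) Let $a^\epsilon\in\mathcal{M}(a_1,a_2)$ and $b^\epsilon\in\mathcal{M}(b_1,b_2)$.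 Then $a^\epsilon$ $H$-converges to $a^*$ and $b^\epsilon$ converges to $b^{\#}$ relative to $a^\epsilon$ if and only if $1/a^\epsilon$ converges to $1/a^*$ in $L^\infty(I)$ weak* (so $a^*=\underline a$ is the harmonic limit), $b^\epsilon/(a^\epsilon)^2$ has an $L^\infty(I)$ weak* limit, and $$b^{\#}=(\underline a)^2\,\lim{}^{*}\,\frac{b^\epsilon}{(a^\epsilon)^2}\quad\text{a.e. in } I .$$ (2) Let $a^\epsilon=a_1\chi_{\omega_A^\epsilon}+a_2(1-\chi_{\omega_A^\epsilon})$ and $b^\epsilon=b_1\chi_{\omega_B^\epsilon}+b_2(1-\chi_{\omega_B^\epsilon})$ with measurable sets such that $\chi_{\omega_A^\epsilon}\rightharpoonup\theta_A$ and $\chi_{\omega_B^\epsilon}\rightharpoonup\theta_B$ in $L^\infty(I)$ weak*. Then $a^\epsilon$ $H$-converges to $\underline a=\left(\frac{\theta_A}{a_1}+\frac{1-\theta_A}{a_2}\right)^{-1}$, and if $b^\epsilon$ converges to $b^{\#}$ relative to $a^\epsilon$, then $l_{\#}(x)\le b^{\#}(x)\le u_{\#}(x)$ for a.e. $x\in I$,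 where $$l_{\#}=\begin{cases}(\underline a)^2\left\{\frac{b_2}{a_2^2}+\frac{b_1-b_2}{a_2^2}\theta_B+b_1\left(\frac1{a_1^2}-\frac1{a_2^2}\right)\theta_A\right\}&\text{if }\theta_A\le\theta_B,\\[2pt](\underline a)^2\left\{\frac{b_2}{a_2^2}+\frac{b_1-b_2}{a_1^2}\theta_B+b_2\left(\frac1{a_1^2}-\frac1{a_2^2}\right)\theta_A\right\}&\text{if }\theta_B\le\theta_A,\end{cases}$$ $$u_{\#}=\begin{cases}(\underline a)^2\left\{\frac{b_2}{a_2^2}+\frac{b_1-b_2}{a_2^2}\theta_B+b_2\left(\frac1{a_1^2}-\frac1{a_2^2}\right)\theta_A\right\}&\text{if }\theta_A+\theta_B\le1,\\[2pt](\underline a)^2\left\{\frac{b_2-b_1}{a_1^2}+\frac{b_1}{a_2^2}+\frac{b_1-b_2}{a_1^2}\theta_B+b_1\left(\frac1{a_1^2}-\frac1{a_2^2}\right)\theta_A\right\}&\text{if }\theta_A+\theta_B\ge1.\end{cases}$$ (3) Conversely, let $\theta_A,\theta_B,v$ be measurable on $I$ with $0\le\theta_A,\theta_B\le1$ and $l_{\#}(x)\le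 v(x)\le u_{\#}(x)$ for a.e. $x\in I$. Then there are sequences of measurable sets $\omega_A^\epsilon,\omega_B^\epsilon$ with $\chi_{\omega_A^\epsilon}\rightharpoonup\theta_A$ and $\chi_{\omega_B^\epsilon}\rightharpoonup\theta_B$ in $L^\infty(I)$ weak* such that the corresponding two-phase coefficients satisfy: $a^\epsilon$ $H$-converges to $\underline a$, and $b^\epsilon$ converges to $v$ relative to $a^\epsilon$. -/

import Mathlib

open MeasureTheory Filter Topology Set
open scoped ContDiff

noncomputable section

namespace RelHom

/-- Lebesgue measure on the bounded open interval `I = (p, q)`. -/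
def vol (p q : ℝ) : Measure ℝ := volume.restrict (Ioo p q)

/-- Test functions: smooth functions with compact support contained in `I = (p, q)`. -/
def IsTestFun (p q : ℝ) (φ : ℝ → ℝ) : Prop :=
  ContDiff ℝ ∞ φ ∧ HasCompactSupport φ ∧ tsupport φ ⊆ Ioo p q

/-- One-dimensional coefficient class `M(c, C; I)`: measurable `f` with `c ≤ f ≤ C` a.e. in `I`. -/
def InM (p q c C : ℝ) (f : ℝ → ℝ) : Prop :=
  AEStronglyMeasurable f (vol p q) ∧ ∀ᵐ x ∂(vol p q), c ≤ f x ∧ f x ≤ C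

/-- Convergence `f n ⇀ g` in `L^∞(I)` weak*, `L^∞(I)` being the dual of `L¹(I)`. -/
def WeakStarConv (p q : ℝ) (f : ℕ → ℝ → ℝ) (g : ℝ → ℝ) : Prop :=
  (∀ n, MemLp (f n) ⊤ (vol p q)) ∧ MemLp g ⊤ (vol p q) ∧
    ∀ h : ℝ → ℝ, Integrable h (vol p q) →
      Tendsto (fun n => ∫ x, f n x * h x ∂(vol p q)) atTop (𝓝 (∫ x, g x * h x ∂(vol p q)))

/-- Weak convergence `f n ⇀ g` in `L²(I)`. -/
def WeakL2Conv (p q : ℝ) (f : ℕ → ℝ → ℝ) (g : ℝ → ℝ) : Prop :=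
  (∀ n, MemLp (f n) 2 (vol p q)) ∧ MemLp g 2 (vol p q) ∧
    ∀ h : ℝ → ℝ, MemLp h 2 (vol p q) →
      Tendsto (fun n => ∫ x, f n x * h x ∂(vol p q)) atTop (𝓝 (∫ x, g x * h x ∂(vol p q)))

/-- `u ∈ H¹(I)` with weak derivative `du`. -/
def IsH1 (p q : ℝ) (u du : ℝ → ℝ) : Prop :=
  MemLp u 2 (vol p q) ∧ MemLp du 2 (vol p q) ∧
    ∀ φ : ℝ → ℝ, IsTestFun p q φ →
      ∫ x, u x * deriv φ x ∂(vol p q) = - ∫ x, du x * φ x ∂(vol p q)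

/-- The norm of a test function in `H¹(I)`. -/
def h1Norm (p q : ℝ) (φ : ℝ → ℝ) : ℝ :=
  Real.sqrt ((∫ x, φ x ^ 2 ∂(vol p q)) + ∫ x, deriv φ x ^ 2 ∂(vol p q))

/-- The distributions `-(σ n)'` (that is, `φ ↦ ∫ σ n φ'`) converge strongly in `H⁻¹(I)`, the dual
of `H¹₀(I)`. The limit is written in the general form `f₀ - f₁'` (`f₀, f₁ ∈ L²(I)`) of an element
of `H⁻¹(I)`, and the dual norm is taken over the test functions, which are dense in `H¹₀(I)`. -/
def DivStrongConv (p q : ℝ) (σ : ℕ → ℝ → ℝ) : Prop :=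
  ∃ f₀ f₁ : ℝ → ℝ, MemLp f₀ 2 (vol p q) ∧ MemLp f₁ 2 (vol p q) ∧
    ∀ δ : ℝ, 0 < δ → ∀ᶠ n in atTop, ∀ φ : ℝ → ℝ, IsTestFun p q φ →
      |(∫ x, σ n x * deriv φ x ∂(vol p q)) -
        ∫ x, (f₀ x * φ x + f₁ x * deriv φ x) ∂(vol p q)| ≤ δ * h1Norm p q φ

/-- Test sequences for the coefficients `a n`: `u n ⇀ u₀` weakly in `H¹(I)` (that is, `u n` and the
derivatives `du n` converge weakly in `L²(I)`), and `-(a n (u n)')'` converges strongly in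
`H⁻¹(I)`. -/
structure IsTestSeq (p q : ℝ) (a : ℕ → ℝ → ℝ) (u du : ℕ → ℝ → ℝ) (u₀ du₀ : ℝ → ℝ) : Prop where
  memH1 : ∀ n, IsH1 p q (u n) (du n)
  memH1_lim : IsH1 p q u₀ du₀
  weak : WeakL2Conv p q u u₀
  weak_deriv : WeakL2Conv p q du du₀
  strong_div : DivStrongConv p q (fun n x => a n x * du n x)

/-- `H`-convergence of `a n` to `aStar` in `M(a₁, a₂; I)`: along every test sequence the fluxes
converge weakly in `L²(I)`. Test sequences along subsequences of `a n` are included, so that the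
notion passes to subsequences and limits are unique, as for the usual notion. -/
def HConverges (p q a₁ a₂ : ℝ) (a : ℕ → ℝ → ℝ) (aStar : ℝ → ℝ) : Prop :=
  (∀ n, InM p q a₁ a₂ (a n)) ∧ InM p q a₁ a₂ aStar ∧
    ∀ k : ℕ → ℕ, StrictMono k → ∀ (u du : ℕ → ℝ → ℝ) (u₀ du₀ : ℝ → ℝ),
      IsTestSeq p q (fun n => a (k n)) u du u₀ du₀ →
        WeakL2Conv p q (fun n x => a (k n) x * du n x) (fun x => aStar x * du₀ x)

/-- `b n` in `M(b₁, b₂; I)` converges to `bSharp` relative to `a n` (which is assumed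
`H`-convergent): along every test sequence for `a n` the energy densities `b n (u n)'²` converge
to `bSharp u₀'²` in the sense of distributions on `I`. -/
def RelConverges (p q b₁ b₂ : ℝ) (a b : ℕ → ℝ → ℝ) (bSharp : ℝ → ℝ) : Prop :=
  (∀ n, InM p q b₁ b₂ (b n)) ∧ MemLp bSharp ⊤ (vol p q) ∧
    ∀ (u du : ℕ → ℝ → ℝ) (u₀ du₀ : ℝ → ℝ), IsTestSeq p q a u du u₀ du₀ →
      ∀ φ : ℝ → ℝ, IsTestFun p q φ →
        Tendsto (fun n => ∫ x, b n x * du n x ^ 2 * φ x ∂(vol p q)) atTop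
          (𝓝 (∫ x, bSharp x * du₀ x ^ 2 * φ x ∂(vol p q)))

/-- The characteristic function of a set. -/
def chi (S : Set ℝ) : ℝ → ℝ := S.indicator (fun _ => 1)

/-- The two-phase coefficient with value `c₁` on `S` and `c₂` outside. -/
def twoPhase (c₁ c₂ : ℝ) (S : Set ℝ) : ℝ → ℝ := fun x => c₁ * chi S x + c₂ * (1 - chi S x)

/-- Harmonic mean of `a₁, a₂` in proportions `s, 1 - s`. -/
def harm (a₁ a₂ s : ℝ) : ℝ := (s / a₁ + (1 - s) / a₂)⁻¹

/-! In the four bounds below `s` and `t` stand for the values `θ_A(x)` and `θ_B(x)`. -/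

def l1 (a₁ a₂ b₁ b₂ s t : ℝ) : ℝ :=
  harm a₁ a₂ s ^ 2 *
    (b₂ / a₂ ^ 2 + (b₁ - b₂) / a₂ ^ 2 * t + b₁ * (1 / a₁ ^ 2 - 1 / a₂ ^ 2) * s)

def l2 (a₁ a₂ b₁ b₂ s t : ℝ) : ℝ :=
  harm a₁ a₂ s ^ 2 *
    (b₂ / a₂ ^ 2 + (b₁ - b₂) / a₁ ^ 2 * t + b₂ * (1 / a₁ ^ 2 - 1 / a₂ ^ 2) * s)

def u1 (a₁ a₂ b₁ b₂ s t : ℝ) : ℝ :=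
  harm a₁ a₂ s ^ 2 *
    (b₂ / a₂ ^ 2 + (b₁ - b₂) / a₂ ^ 2 * t + b₂ * (1 / a₁ ^ 2 - 1 / a₂ ^ 2) * s)

def u2 (a₁ a₂ b₁ b₂ s t : ℝ) : ℝ :=
  harm a₁ a₂ s ^ 2 *
    ((b₂ - b₁) / a₁ ^ 2 + b₁ / a₂ ^ 2 + (b₁ - b₂) / a₁ ^ 2 * t
      + b₁ * (1 / a₁ ^ 2 - 1 / a₂ ^ 2) * s)

/-- The lower bound (`l1` and `l2` agree when `s = t`). -/
def lSharp (a₁ a₂ b₁ b₂ s t : ℝ) : ℝ :=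
  if s ≤ t then l1 a₁ a₂ b₁ b₂ s t else l2 a₁ a₂ b₁ b₂ s t

/-- The upper bound (`u1` and `u2` agree when `s + t = 1`). -/
def uSharp (a₁ a₂ b₁ b₂ s t : ℝ) : ℝ :=
  if s + t ≤ 1 then u1 a₁ a₂ b₁ b₂ s t else u2 a₁ a₂ b₁ b₂ s t

end RelHom

end

/-! In one dimension a flux is determined by its divergence up to an additive constant, so strong
`H⁻¹` convergence of `-(a n * du n)'` forces the fluxes `a n * du n` to converge strongly in `L²`
modulo constants `c n` (`DivStrongConv.exists_tendsto_lpNorm`). Weak convergence of `du n` and the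
positive lower bound on the integrals of `1 / a n` make `c n` converge. Thus the flux converges
strongly to some `σ`, and passing to the limit in `du n = (1 / a n) * flux` gives `σ = aStar * du₀`
(`IsTestSeq.exists_tendsto_lpNorm_flux`). The energy density is `(b n / a n ^ 2) * flux ^ 2`, a
weak* convergent factor times a strongly convergent one, so its limit is `m * aStar ^ 2 * du₀ ^ 2`.

Conversely, the sequence with flux identically `1` has derivative `1 / a n` and energy density `b n
/ a n ^ 2`; inserting it into the two definitions recovers both weak* limits.

For two phases, `b / a ^ 2` is affine in `χ_A`, `χ_B` and `χ_A χ_B`, with nonpositive coefficient on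
the product. Only the limit `k` of the overlap is free, and `max 0 (s + t - 1) ≤ k ≤ min s t`. The
largest overlap gives `lSharp`, the smallest `uSharp`. For attainment, the equation for `k` is
solved pointwise, and layered sets that are monotone in their density realise `θA`, `θB` and the
overlap `k` simultaneously. -/

namespace RelHom

/-! ### Cauchy–Schwarz in `L²` -/

section general

variable {α : Type*} {m0 : MeasurableSpace α} {μ : Measure α}

theorem lpNorm_two_sq {f : α → ℝ} (hf : AEStronglyMeasurable f μ) :
    lpNorm f 2 μ ^ 2 = ∫ x, f x ^ 2 ∂μ := by
  rw [lpNorm_eq_integral_norm_rpow_toReal (by norm_num) (by norm_num) hf]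
  have h : ∀ x, ‖f x‖ ^ (2 : ENNReal).toReal = f x ^ 2 := fun x => by simp
  simp_rw [h]
  rw [← Real.rpow_natCast, ← Real.rpow_mul (integral_nonneg fun x => sq_nonneg _)]
  norm_num

theorem integrable_two_mul {f g : α → ℝ} (hf : MemLp f 2 μ) (hg : MemLp g 2 μ) :
    Integrable (fun x => f x * g x) μ :=
  hf.integrable_mul hg

theorem integral_abs_mul_le {f g : α → ℝ} (hf : MemLp f 2 μ) (hg : MemLp g 2 μ) :
    ∫ x, |f x * g x| ∂μ ≤ lpNorm f 2 μ * lpNorm g 2 μ := by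
  have h := integral_mul_norm_le_Lp_mul_Lq (μ := μ) (f := f) (g := g)
    (p := 2) (q := 2) Real.HolderConjugate.two_two (by simpa using hf) (by simpa using hg)
  rw [lpNorm_eq_integral_norm_rpow_toReal (by norm_num) (by norm_num) hf.1,
    lpNorm_eq_integral_norm_rpow_toReal (by norm_num) (by norm_num) hg.1]
  simpa [abs_mul] using h

theorem abs_integral_mul_le {f g : α → ℝ} (hf : MemLp f 2 μ) (hg : MemLp g 2 μ) :
    |∫ x, f x * g x ∂μ| ≤ lpNorm f 2 μ * lpNorm g 2 μ :=
  (abs_integral_le_integral_abs).trans (integral_abs_mul_le hf hg)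

end general

/-! ### Test functions and their density -/

instance isFiniteMeasure_vol (p q : ℝ) : IsFiniteMeasure (vol p q) := by
  unfold vol; infer_instance

theorem IsTestFun.continuous {p q : ℝ} {φ : ℝ → ℝ} (h : IsTestFun p q φ) : Continuous φ :=
  h.1.continuous

theorem IsTestFun.memLp {p q : ℝ} {φ : ℝ → ℝ} (h : IsTestFun p q φ) (r : ENNReal) :
    MemLp φ r (vol p q) :=
  h.continuous.memLp_of_hasCompactSupport h.2.1

theorem IsTestFun.deriv {p q : ℝ} {φ : ℝ → ℝ} (h : IsTestFun p q φ) :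
    IsTestFun p q (deriv φ) :=
  ⟨(contDiff_infty_iff_deriv.1 h.1).2, h.2.1.deriv,
    (closure_minimal support_deriv_subset (isClosed_tsupport φ)).trans h.2.2⟩

theorem IsTestFun.differentiable {p q : ℝ} {φ : ℝ → ℝ} (h : IsTestFun p q φ) :
    Differentiable ℝ φ :=
  (contDiff_infty_iff_deriv.1 h.1).1

theorem IsTestFun.eq_zero {p q : ℝ} {φ : ℝ → ℝ} (h : IsTestFun p q φ) {x : ℝ}
    (hx : x ∉ Ioo p q) : φ x = 0 :=
  image_eq_zero_of_notMem_tsupport fun hx' => hx (h.2.2 hx')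

theorem IsTestFun.sub {p q : ℝ} {φ ψ : ℝ → ℝ} (h : IsTestFun p q φ) (h' : IsTestFun p q ψ) :
    IsTestFun p q (φ - ψ) :=
  ⟨h.1.sub h'.1, h.2.1.sub h'.2.1,
    (tsupport_sub φ ψ).trans (union_subset h.2.2 h'.2.2)⟩

theorem IsTestFun.const_mul {p q : ℝ} {φ : ℝ → ℝ} (h : IsTestFun p q φ) (c : ℝ) :
    IsTestFun p q (fun x => c * φ x) :=
  ⟨contDiff_const.mul h.1, h.2.1.mul_left, (tsupport_mul_subset_right).trans h.2.2⟩

/-- A smooth compactly supported approximation on the line is cut off by a bump equal to `1` away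
from the endpoints. The cutoff changes it only on two boundary layers, whose small measure makes its
norm there small. -/
theorem exists_isTestFun_eLpNorm_sub_le {p q : ℝ} (hpq : p < q) {r : ENNReal} (hr : r ≠ ⊤)
    (hr' : 1 ≤ r) {f : ℝ → ℝ} (hf : MemLp f r (vol p q)) {ε : ℝ} (hε : 0 < ε) :
    ∃ φ, IsTestFun p q φ ∧ eLpNorm (f - φ) r (vol p q) ≤ ENNReal.ofReal ε := by
  have hε2 : 0 < ε / 2 := half_pos hε
  obtain ⟨g, hg₁, hg₂, hg₃⟩ := hf.exist_eLpNorm_sub_le hr hr' hε2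
  have hg : MemLp g r (vol p q) := hg₂.continuous.memLp_of_hasCompactSupport hg₁
  obtain ⟨δ, hδ, hδ'⟩ := hg.eLpNorm_indicator_le hr' hr hε2
  -- The two layers have width `2 * η` each, so total measure at most `δ`; the second bound keeps
  -- the bump's radii positive.
  set η : ℝ := min (δ / 4) ((q - p) / 4)
  have hη : 0 < η := lt_min (by linarith) (by linarith)
  have hη1 : η ≤ δ / 4 := min_le_left _ _
  have hη2 : η ≤ (q - p) / 4 := min_le_right _ _
  let χ : ContDiffBump ((p + q) / 2) :=
    ⟨(q - p) / 2 - 2 * η + η / 2, (q - p) / 2 - η, by linarith, by linarith⟩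
  have hχ1 : ∀ x ∈ Icc (p + 2 * η) (q - 2 * η), χ x = 1 := fun x hx => by
    apply χ.one_of_mem_closedBall
    rw [Real.closedBall_eq_Icc]
    constructor <;> simp only [χ] <;> linarith [hx.1, hx.2]
  refine ⟨fun x => χ x * g x, ⟨χ.contDiff.mul hg₂, hg₁.mul_left, ?_⟩, ?_⟩
  · refine tsupport_mul_subset_left.trans ?_
    rw [χ.tsupport_eq, Real.closedBall_eq_Icc]
    intro x hx
    simp only [χ] at hx
    constructor <;> linarith [hx.1, hx.2]
  · set s : Set ℝ := (Icc (p + 2 * η) (q - 2 * η))ᶜ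
    have hs : MeasurableSet s := measurableSet_Icc.compl
    have hμs : vol p q s ≤ ENNReal.ofReal δ := by
      have hsub : s ∩ Ioo p q ⊆ Ioo p (p + 2 * η) ∪ Ioo (q - 2 * η) q := by
        rintro x ⟨hx, hx'⟩
        by_cases h : x < p + 2 * η
        · exact Or.inl ⟨hx'.1, h⟩
        · refine Or.inr ⟨?_, hx'.2⟩
          by_contra h'
          exact hx ⟨not_lt.1 h, not_lt.1 h'⟩
      rw [vol, Measure.restrict_apply hs]
      refine (measure_mono hsub).trans ((measure_union_le _ _).trans ?_)
      rw [Real.volume_Ioo, Real.volume_Ioo, ← ENNReal.ofReal_add (by linarith) (by linarith)]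
      exact ENNReal.ofReal_le_ofReal (by linarith)
    have h1 : eLpNorm (g - fun x => χ x * g x) r (vol p q) ≤ ENNReal.ofReal (ε / 2) := by
      refine (eLpNorm_mono fun x => ?_).trans (hδ' s hs hμs)
      by_cases hx : x ∈ s
      · rw [indicator_of_mem hx]
        have : (g - fun x => χ x * g x) x = (1 - χ x) * g x := by
          simp only [Pi.sub_apply]; ring
        rw [this, norm_mul]
        refine mul_le_of_le_one_left (norm_nonneg _) ?_
        rw [Real.norm_eq_abs, abs_le]
        constructor <;> linarith [χ.nonneg (x := x), χ.le_one (x := x)]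
      · have : χ x = 1 := hχ1 x (by simpa [s] using hx)
        simp [this]
    have h2 : f - (fun x => χ x * g x) = (f - g) + (g - fun x => χ x * g x) := by simp
    rw [h2]
    refine (eLpNorm_add_le (hf.1.sub hg.1) (hg.1.sub ?_) hr').trans ?_
    · exact (χ.continuous.mul hg₂.continuous).aestronglyMeasurable
    · refine (add_le_add hg₃ h1).trans ?_
      rw [← ENNReal.ofReal_add hε2.le hε2.le, add_halves]

theorem exists_isTestFun_lpNorm_sub_le {p q : ℝ} (hpq : p < q) {r : ENNReal} (hr : r ≠ ⊤)
    (hr' : 1 ≤ r) {f : ℝ → ℝ} (hf : MemLp f r (vol p q)) {ε : ℝ} (hε : 0 < ε) :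
    ∃ φ, IsTestFun p q φ ∧ lpNorm (f - φ) r (vol p q) ≤ ε := by
  obtain ⟨φ, h, h'⟩ := exists_isTestFun_eLpNorm_sub_le hpq hr hr' hf hε
  refine ⟨φ, h, ?_⟩
  rw [← ofReal_lpNorm (hf.sub (h.memLp r))] at h'
  exact (ENNReal.ofReal_le_ofReal_iff hε.le).1 h'

/-! ### Primitives and integration by parts -/

theorem integral_vol_eq {p q : ℝ} (hpq : p < q) (f : ℝ → ℝ) :
    ∫ x, f x ∂(vol p q) = ∫ x in p..q, f x := by
  rw [intervalIntegral.integral_of_le hpq.le, vol, integral_Ioc_eq_integral_Ioo]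

theorem primitive_eq_setIntegral_Iio {p q : ℝ} (f : ℝ → ℝ) {x : ℝ} (hx : x ∈ Ioo p q) :
    ∫ t in p..x, f t = ∫ t in Iio x, f t ∂(vol p q) := by
  have h : Ioo p x = Iio x ∩ Ioo p q := by
    ext t
    exact ⟨fun h => ⟨h.2, h.1, h.2.trans hx.2⟩, fun h => ⟨h.2.1, h.1⟩⟩
  rw [intervalIntegral.integral_of_le hx.1.le, integral_Ioc_eq_integral_Ioo, h, vol,
    Measure.restrict_restrict measurableSet_Iio]

/-- Integration by parts for the primitive of an integrable function. -/
theorem integral_primitive_mul_deriv {p q : ℝ} {f φ : ℝ → ℝ}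
    (hf : Integrable f (vol p q)) (hφ : IsTestFun p q φ) :
    ∫ x, (∫ t in p..x, f t) * deriv φ x ∂(vol p q) = - ∫ x, f x * φ x ∂(vol p q) := by
  have hφ' : Continuous (deriv φ) := hφ.deriv.continuous
  -- With the kernel `1_{t < x}` the claim is Fubini: the inner integral becomes that of `deriv φ`
  -- over `(t, q)`, which is `-φ t`.
  have key : ∀ x ∈ Ioo p q, (∫ t in p..x, f t) =
      ∫ t, (Ioi t).indicator (fun _ => (1 : ℝ)) x * f t ∂(vol p q) := by
    intro x hx
    rw [primitive_eq_setIntegral_Iio f hx, ← integral_indicator measurableSet_Iio]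
    refine integral_congr_ae (Eventually.of_forall fun t => ?_)
    by_cases ht : t < x
    · simp [indicator, ht]
    · simp [indicator, ht]
  have e1 : ∫ x, (∫ t in p..x, f t) * deriv φ x ∂(vol p q) =
      ∫ x, ∫ t, (Ioi t).indicator (fun _ => (1 : ℝ)) x * f t * deriv φ x ∂(vol p q) ∂(vol p q) := by
    refine setIntegral_congr_fun measurableSet_Ioo fun x hx => ?_
    rw [key x hx, ← integral_mul_const]
  have hint : Integrable (Function.uncurry fun x t : ℝ =>
      (Ioi t).indicator (fun _ => (1 : ℝ)) x * f t * deriv φ x) ((vol p q).prod (vol p q)) := by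
    have hb : Integrable (fun z : ℝ × ℝ => deriv φ z.1 * f z.2) ((vol p q).prod (vol p q)) :=
      ((memLp_one_iff_integrable.1 (hφ.deriv.memLp 1))).mul_prod hf
    have hs : MeasurableSet {z : ℝ × ℝ | z.2 < z.1} :=
      measurableSet_lt measurable_snd measurable_fst
    refine (hb.indicator hs).congr (Eventually.of_forall ?_)
    rintro ⟨x, t⟩
    by_cases ht : t < x
    · simp [indicator, ht, mul_comm]
    · simp [indicator, ht]
  rw [e1, integral_integral_swap hint, ← integral_neg]
  refine setIntegral_congr_fun measurableSet_Ioo fun t ht => ?_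
  have e2 : ∀ x, (Ioi t).indicator (fun _ => (1 : ℝ)) x * f t * deriv φ x =
      f t * (Ioi t).indicator (deriv φ) x := by
    intro x
    by_cases hx : t < x
    · simp [indicator, hx]
    · simp [indicator, hx]
  simp_rw [e2]
  rw [integral_const_mul, integral_indicator measurableSet_Ioi, vol,
    Measure.restrict_restrict measurableSet_Ioi,
    show Ioi t ∩ Ioo p q = Ioo t q by
      ext x
      exact ⟨fun h => ⟨h.1, h.2.2⟩, fun h => ⟨h.1, ht.1.trans h.1, h.2⟩⟩,
    ← integral_Ioc_eq_integral_Ioo, ← intervalIntegral.integral_of_le ht.2.le,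
    intervalIntegral.integral_deriv_eq_sub (fun x _ => hφ.differentiable x)
      (hφ'.intervalIntegrable _ _), hφ.eq_zero (x := q) (by simp)]
  ring

/-! ### Bounded multipliers and weak compactness -/

section general

variable {α : Type*} {m0 : MeasurableSpace α} {μ : Measure α}

theorem abs_integral_bdd_mul_le {f h : α → ℝ} {C : ℝ} (hf : ∀ᵐ x ∂μ, |f x| ≤ C)
    (hh : Integrable h μ) : |∫ x, f x * h x ∂μ| ≤ C * ∫ x, |h x| ∂μ := by
  have e : ∫ x, C * |h x| ∂μ = C * ∫ x, |h x| ∂μ := integral_const_mul _ _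
  rw [← e, ← Real.norm_eq_abs]
  refine norm_integral_le_of_norm_le (hh.abs.const_mul C) ?_
  filter_upwards [hf] with x hx
  simpa [abs_mul] using mul_le_mul_of_nonneg_right hx (abs_nonneg (h x))

theorem integrable_bdd_mul {f h : α → ℝ} {C : ℝ} (hfm : AEStronglyMeasurable f μ)
    (hf : ∀ᵐ x ∂μ, |f x| ≤ C) (hh : Integrable h μ) : Integrable (fun x => f x * h x) μ :=
  hh.bdd_mul hfm hf

theorem MemLp.exists_bound {f : α → ℝ} (hf : MemLp f ⊤ μ) : ∃ C, 0 ≤ C ∧ ∀ᵐ x ∂μ, |f x| ≤ C :=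
  ⟨lpNorm f ⊤ μ, lpNorm_nonneg, ae_le_lpNorm_exponent_top hf⟩

theorem integrable_top_mul {f h : α → ℝ} (hf : MemLp f ⊤ μ) (hh : Integrable h μ) :
    Integrable (fun x => f x * h x) μ := by
  obtain ⟨C, -, hC⟩ := MemLp.exists_bound hf
  exact integrable_bdd_mul hf.1 hC hh

theorem memLp_two_bdd_mul {f h : α → ℝ} {C : ℝ} (hfm : AEStronglyMeasurable f μ)
    (hf : ∀ᵐ x ∂μ, |f x| ≤ C) (hh : MemLp h 2 μ) : MemLp (fun x => f x * h x) 2 μ :=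
  hh.mul (p := ⊤) (memLp_top_of_bound hfm C hf)

/-- An a.e. inequality is detected by integrals over measurable sets, and these pass to the limit.
-/
theorem ae_le_of_tendsto_setIntegral {f k : ℕ → α → ℝ} {F K : α → ℝ}
    (hf : ∀ n, Integrable (f n) μ) (hk : ∀ n, Integrable (k n) μ)
    (hF : Integrable F μ) (hK : Integrable K μ) (hle : ∀ n, ∀ᵐ x ∂μ, f n x ≤ k n x)
    (hfF : ∀ s, MeasurableSet s → Tendsto (fun n => ∫ x in s, f n x ∂μ) atTop (𝓝 (∫ x in s, F x ∂μ)))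
    (hkK : ∀ s, MeasurableSet s →
      Tendsto (fun n => ∫ x in s, k n x ∂μ) atTop (𝓝 (∫ x in s, K x ∂μ))) :
    ∀ᵐ x ∂μ, F x ≤ K x := by
  refine ae_le_of_forall_setIntegral_le hF hK fun s hs _ => ?_
  refine le_of_tendsto_of_tendsto' (hfF s hs) (hkK s hs) fun n => ?_
  exact integral_mono_ae (hf n).restrict (hk n).restrict (ae_restrict_of_ae (hle n))

theorem integral_mul_indicator_one {s : Set α} (hs : MeasurableSet s) (f : α → ℝ) :
    ∫ x, f x * s.indicator (fun _ => 1) x ∂μ = ∫ x in s, f x ∂μ := by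
  rw [← integral_indicator hs]
  refine integral_congr_ae (Eventually.of_forall fun x => ?_)
  by_cases hx : x ∈ s <;> simp [hx]

/-- Sequential weak compactness in `L²` of bounded sets of functions between two constants. -/
theorem exists_subseq_tendsto_integral_mul [IsFiniteMeasure μ] [IsSeparable μ] {f : ℕ → α → ℝ}
    {c C : ℝ} (hfm : ∀ n, AEStronglyMeasurable (f n) μ)
    (hf : ∀ n, ∀ᵐ x ∂μ, c ≤ f n x ∧ f n x ≤ C) :
    ∃ k : ℕ → ℕ, StrictMono k ∧ ∃ g : α → ℝ, AEStronglyMeasurable g μ ∧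
      (∀ᵐ x ∂μ, c ≤ g x ∧ g x ≤ C) ∧ ∀ h : α → ℝ, MemLp h 2 μ →
        Tendsto (fun n => ∫ x, f (k n) x * h x ∂μ) atTop (𝓝 (∫ x, g x * h x ∂μ)) := by
  have : Fact ((2 : ENNReal) ≠ ⊤) := ⟨by norm_num⟩
  set M : ℝ := max |c| |C|
  have hM : ∀ n, ∀ᵐ x ∂μ, ‖f n x‖ ≤ M := fun n => by
    filter_upwards [hf n] with x hx
    exact abs_le_max_abs_abs hx.1 hx.2
  have hf2 : ∀ n, MemLp (f n) 2 μ := fun n => MemLp.of_bound (hfm n) M (hM n)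
  let F : ℕ → Lp ℝ 2 μ := fun n => (hf2 n).toLp
  let D : ℕ → WeakDual ℝ (Lp ℝ 2 μ) := fun n =>
    StrongDual.toWeakDual (InnerProductSpace.toDual ℝ _ (F n))
  obtain ⟨R, hR⟩ : ∃ R : ℝ, ∀ n, ‖F n‖ ≤ R := by
    refine ⟨(measureUnivNNReal μ : ℝ) ^ (2 : ENNReal).toReal⁻¹ * M, fun n => ?_⟩
    refine Lp.norm_le_of_ae_bound (le_max_of_le_left (abs_nonneg c)) ?_
    filter_upwards [hM n, (hf2 n).coeFn_toLp] with x hx hx'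
    rwa [hx']
  -- Riesz representation turns the bounded sequence into one in a ball of the weak dual,
  -- sequentially compact because `L²` is separable here.
  obtain ⟨G, -, k, hk, hG⟩ := (WeakDual.isSeqCompact_closedBall ℝ (Lp ℝ 2 μ) 0 R)
    (x := D) (fun n => by
      simp only [D, mem_preimage, Metric.mem_closedBall, dist_zero_right]
      exact ((InnerProductSpace.toDual ℝ _).norm_map (F n)).trans_le (hR n))
  let g : Lp ℝ 2 μ := (InnerProductSpace.toDual ℝ _).symm (WeakDual.toStrongDual G)
  have hconv : ∀ h : α → ℝ, MemLp h 2 μ →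
      Tendsto (fun n => ∫ x, f (k n) x * h x ∂μ) atTop (𝓝 (∫ x, g x * h x ∂μ)) := by
    intro h hh
    have h1 := (WeakDual.eval_continuous (𝕜 := ℝ) (hh.toLp : Lp ℝ 2 μ)).continuousAt.tendsto.comp hG
    have e : ∀ v : Lp ℝ 2 μ, inner ℝ v (hh.toLp : Lp ℝ 2 μ) = ∫ x, v x * h x ∂μ := by
      intro v
      rw [L2.inner_def]
      refine integral_congr_ae ?_
      filter_upwards [hh.coeFn_toLp] with x hx
      simp [hx, mul_comm]
    have e1 : ∀ n, (D n) (hh.toLp : Lp ℝ 2 μ) = ∫ x, f n x * h x ∂μ := by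
      intro n
      change inner ℝ (F n) (hh.toLp : Lp ℝ 2 μ) = _
      rw [e]
      refine integral_congr_ae ?_
      filter_upwards [(hf2 n).coeFn_toLp] with x hx
      simp only [F]
      rw [hx]
    have e2 : G (hh.toLp : Lp ℝ 2 μ) = ∫ x, g x * h x ∂μ := by
      rw [← e, InnerProductSpace.toDual_symm_apply]
      rfl
    rw [e2] at h1
    refine h1.congr fun n => ?_
    exact e1 _
  have hset : ∀ s, MeasurableSet s → Tendsto (fun n => ∫ x in s, f (k n) x ∂μ) atTop
      (𝓝 (∫ x in s, g x ∂μ)) := fun s hs => by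
    have := hconv (s.indicator fun _ => 1) (MemLp.indicator hs (memLp_const 1))
    simpa only [integral_mul_indicator_one hs] using this
  have hgi : Integrable g μ := (Lp.memLp g).integrable (by norm_num)
  refine ⟨k, hk, g, (Lp.memLp g).1, ?_, hconv⟩
  have h1 := ae_le_of_tendsto_setIntegral (μ := μ) (f := fun _ _ => c) (F := fun _ => c)
    (k := fun n => f (k n)) (K := g) (fun _ => integrable_const c)
    (fun n => (hf2 (k n)).integrable (by norm_num)) (integrable_const c) hgi
    (fun n => (hf (k n)).mono fun x hx => hx.1) (fun _ _ => tendsto_const_nhds) hset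
  have h2 := ae_le_of_tendsto_setIntegral (μ := μ) (k := fun _ _ => C) (K := fun _ => C)
    (f := fun n => f (k n)) (F := g) 
    (fun n => (hf2 (k n)).integrable (by norm_num)) (fun _ => integrable_const C) hgi
    (integrable_const C)
    (fun n => (hf (k n)).mono fun x hx => hx.2) hset (fun _ _ => tendsto_const_nhds)
  filter_upwards [h1, h2] with x hx hx' using ⟨hx, hx'⟩

end general

/-! ### Calculus of weak* convergence -/

theorem WeakStarConv.tendsto_setIntegral {p q : ℝ} {f : ℕ → ℝ → ℝ} {F : ℝ → ℝ}
    (hf : WeakStarConv p q f F) {s : Set ℝ} (hs : MeasurableSet s) :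
    Tendsto (fun n => ∫ x in s, f n x ∂(vol p q)) atTop (𝓝 (∫ x in s, F x ∂(vol p q))) := by
  have := hf.2.2 (s.indicator fun _ => 1) ((integrable_const 1).indicator hs)
  simpa only [integral_mul_indicator_one hs] using this

theorem WeakStarConv.ae_le {p q : ℝ} {f k : ℕ → ℝ → ℝ} {F K : ℝ → ℝ}
    (hf : WeakStarConv p q f F) (hk : WeakStarConv p q k K)
    (hle : ∀ n, ∀ᵐ x ∂(vol p q), f n x ≤ k n x) : ∀ᵐ x ∂(vol p q), F x ≤ K x :=
  ae_le_of_tendsto_setIntegral (fun n => (hf.1 n).integrable le_top)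
    (fun n => (hk.1 n).integrable le_top) (hf.2.1.integrable le_top) (hk.2.1.integrable le_top) hle
    (fun _ hs => hf.tendsto_setIntegral hs) (fun _ hs => hk.tendsto_setIntegral hs)

theorem WeakStarConv.const (p q c : ℝ) : WeakStarConv p q (fun _ _ => c) (fun _ => c) :=
  ⟨fun _ => memLp_const c, memLp_const c, fun _ _ => tendsto_const_nhds⟩

theorem WeakStarConv.add {p q : ℝ} {f k : ℕ → ℝ → ℝ} {F K : ℝ → ℝ}
    (hf : WeakStarConv p q f F) (hk : WeakStarConv p q k K) :
    WeakStarConv p q (fun n x => f n x + k n x) (fun x => F x + K x) := by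
  refine ⟨fun n => (hf.1 n).add (hk.1 n), hf.2.1.add hk.2.1, fun h hh => ?_⟩
  have := (hf.2.2 h hh).add (hk.2.2 h hh)
  rw [← integral_add (integrable_top_mul hf.2.1 hh) (integrable_top_mul hk.2.1 hh)] at this
  simp_rw [add_mul]
  refine this.congr fun n => ?_
  rw [← integral_add (integrable_top_mul (hf.1 n) hh) (integrable_top_mul (hk.1 n) hh)]

theorem WeakStarConv.const_mul {p q : ℝ} {f : ℕ → ℝ → ℝ} {F : ℝ → ℝ}
    (hf : WeakStarConv p q f F) (c : ℝ) :
    WeakStarConv p q (fun n x => c * f n x) (fun x => c * F x) := by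
  refine ⟨fun n => (hf.1 n).const_mul c, hf.2.1.const_mul c, fun h hh => ?_⟩
  simp_rw [mul_assoc, integral_const_mul]
  exact (hf.2.2 h hh).const_mul c

theorem WeakStarConv.sub {p q : ℝ} {f k : ℕ → ℝ → ℝ} {F K : ℝ → ℝ}
    (hf : WeakStarConv p q f F) (hk : WeakStarConv p q k K) :
    WeakStarConv p q (fun n x => f n x - k n x) (fun x => F x - K x) := by
  have := hf.add (hk.const_mul (-1))
  simpa only [neg_one_mul, ← sub_eq_add_neg] using this

theorem WeakStarConv.congr {p q : ℝ} {f k : ℕ → ℝ → ℝ} {F K : ℝ → ℝ}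
    (hf : WeakStarConv p q f F) (h : ∀ n, ∀ᵐ x ∂(vol p q), f n x = k n x)
    (h' : ∀ᵐ x ∂(vol p q), F x = K x) : WeakStarConv p q k K := by
  refine ⟨fun n => (hf.1 n).ae_eq (h n), hf.2.1.ae_eq h', fun g hg => ?_⟩
  have e : ∫ x, F x * g x ∂(vol p q) = ∫ x, K x * g x ∂(vol p q) :=
    integral_congr_ae (h'.mono fun x hx => by simp only [hx])
  rw [← e]
  refine (hf.2.2 g hg).congr fun n => ?_
  exact integral_congr_ae ((h n).mono fun x hx => by simp only [hx])

theorem WeakStarConv.subseq {p q : ℝ} {f : ℕ → ℝ → ℝ} {F : ℝ → ℝ}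
    (hf : WeakStarConv p q f F) {k : ℕ → ℕ} (hk : StrictMono k) :
    WeakStarConv p q (fun n => f (k n)) F :=
  ⟨fun _ => hf.1 _, hf.2.1, fun h hh => (hf.2.2 h hh).comp hk.tendsto_atTop⟩

/-- For sequences bounded in `L^∞`, convergence in the sense of distributions implies weak*
convergence. -/
theorem weakStarConv_of_isTestFun {p q : ℝ} (hpq : p < q) {f : ℕ → ℝ → ℝ} {g : ℝ → ℝ} {C : ℝ}
    (hfm : ∀ n, AEStronglyMeasurable (f n) (vol p q)) (hf : ∀ n, ∀ᵐ x ∂(vol p q), |f n x| ≤ C)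
    (hg : MemLp g ⊤ (vol p q))
    (H : ∀ φ, IsTestFun p q φ → Tendsto (fun n => ∫ x, f n x * φ x ∂(vol p q)) atTop
      (𝓝 (∫ x, g x * φ x ∂(vol p q)))) : WeakStarConv p q f g := by
  refine ⟨fun n => memLp_top_of_bound (hfm n) C (hf n), hg, fun h hh => ?_⟩
  obtain ⟨C', hC', hgb⟩ := MemLp.exists_bound hg
  rw [Metric.tendsto_atTop]
  intro ε hε
  -- `K` dominates both sup bounds and is positive, so replacing `h` by `φ` costs at most `ε / 2` in
  -- total.
  set K : ℝ := |C| + C' + 1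
  have hK : 0 < K := by positivity
  obtain ⟨φ, hφ, hφε⟩ := exists_isTestFun_lpNorm_sub_le hpq ENNReal.one_ne_top le_rfl
    (memLp_one_iff_integrable.2 hh) (ε := ε / (2 * K)) (by positivity)
  have hφi : Integrable φ (vol p q) := memLp_one_iff_integrable.1 (hφ.memLp 1)
  rw [lpNorm_one_eq_integral_norm (hh.sub hφi).1] at hφε
  obtain ⟨N, hN⟩ := Metric.tendsto_atTop.1 (H φ hφ) (ε / 2) (half_pos hε)
  refine ⟨N, fun n hn => ?_⟩
  have split : ∀ k : ℝ → ℝ, ∀ B : ℝ, MemLp k ⊤ (vol p q) → (∀ᵐ x ∂(vol p q), |k x| ≤ B) →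
      |∫ x, k x * h x ∂(vol p q) - ∫ x, k x * φ x ∂(vol p q)| ≤
        B * ∫ x, ‖(h - φ) x‖ ∂(vol p q) := by
    intro k B hk hB
    rw [← integral_sub (integrable_top_mul hk hh) (integrable_top_mul hk hφi)]
    simp_rw [← mul_sub]
    exact abs_integral_bdd_mul_le hB (hh.sub hφi)
  have h1 := split (f n) C (memLp_top_of_bound (hfm n) C (hf n)) (hf n)
  have h2 := split g C' hg hgb
  have h3 := hN n hn
  rw [Real.dist_eq] at h3 ⊢
  have hI : 0 ≤ ∫ x, ‖(h - φ) x‖ ∂(vol p q) := integral_nonneg fun x => norm_nonneg _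
  have h4 : (C + C') * ∫ x, ‖(h - φ) x‖ ∂(vol p q) ≤ ε / 2 := by
    calc (C + C') * ∫ x, ‖(h - φ) x‖ ∂(vol p q) ≤ K * (ε / (2 * K)) := by
          refine mul_le_mul ?_ hφε hI hK.le
          simp only [K]; linarith [le_abs_self C]
      _ = ε / 2 := by field_simp
  rw [abs_le] at h1 h2
  rw [abs_lt] at h3 ⊢
  constructor <;> linarith [h1.1, h1.2, h2.1, h2.2, h3.1, h3.2]

instance isSeparable_vol (p q : ℝ) : IsSeparable (vol p q) := by
  unfold vol; infer_instance

/-- Sequential weak* compactness of order intervals in `L^∞`. -/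
theorem exists_subseq_weakStarConv {p q : ℝ} (hpq : p < q) {f : ℕ → ℝ → ℝ} {c C : ℝ}
    (hf : ∀ n, InM p q c C (f n)) :
    ∃ k : ℕ → ℕ, StrictMono k ∧ ∃ g, InM p q c C g ∧ WeakStarConv p q (fun n => f (k n)) g := by
  obtain ⟨k, hk, g, hgm, hg, H⟩ := exists_subseq_tendsto_integral_mul (fun n => (hf n).1)
    (fun n => (hf n).2)
  refine ⟨k, hk, g, ⟨hgm, hg⟩, ?_⟩
  refine weakStarConv_of_isTestFun hpq (C := max |c| |C|) (fun n => (hf _).1) (fun n => ?_)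
    (memLp_top_of_bound hgm (max |c| |C|) ?_) fun φ hφ => H φ (hφ.memLp 2)
  · exact (hf _).2.mono fun x hx => abs_le_max_abs_abs hx.1 hx.2
  · exact hg.mono fun x hx => abs_le_max_abs_abs hx.1 hx.2

/-! ### From `H⁻¹` convergence of divergences to `L²` convergence of fluxes -/

/-- The primitive from `p` vanishes to the left of the support of `ψ` trivially, and to its right
because the total integral is zero. -/
theorem exists_isTestFun_deriv_eq {p q : ℝ} (hpq : p < q) {ψ : ℝ → ℝ} (hψ : IsTestFun p q ψ)
    (h0 : ∫ x, ψ x ∂(vol p q) = 0) : ∃ φ, IsTestFun p q φ ∧ deriv φ = ψ := by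
  obtain ⟨c, d, hc, hd, hcd⟩ : ∃ c d, p < c ∧ d < q ∧ tsupport ψ ⊆ Icc c d := by
    rcases (tsupport ψ).eq_empty_or_nonempty with h | h
    -- For `ψ = 0` this interval may be empty; only the position of its ends relative to `p` and `q`
    -- is used.
    · exact ⟨p + 1, q - 1, by linarith, by linarith, by simp [h]⟩
    · have hK : IsCompact (tsupport ψ) := hψ.2.1
      obtain ⟨c, hc⟩ := hK.exists_isLeast h
      obtain ⟨d, hd⟩ := hK.exists_isGreatest h
      exact ⟨c, d, (hψ.2.2 hc.1).1, (hψ.2.2 hd.1).2, fun x hx => ⟨hc.2 hx, hd.2 hx⟩⟩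
  have hz : ∀ x, x ∉ Icc c d → ψ x = 0 := fun x hx =>
    image_eq_zero_of_notMem_tsupport fun h => hx (hcd h)
  have hder : ∀ x, HasDerivAt (fun y => ∫ t in p..y, ψ t) (ψ x) x := fun x =>
    (hψ.continuous.integral_hasStrictDerivAt p x).hasDerivAt
  have hd' : deriv (fun y => ∫ t in p..y, ψ t) = ψ := funext fun x => (hder x).deriv
  have hφ0 : ∀ x, x ∉ Icc c d → ∫ t in p..x, ψ t = 0 := by
    intro x hx
    have hzero : ∀ u v : ℝ, (∀ t ∈ uIcc u v, t ∉ Icc c d) → ∫ t in u..v, ψ t = 0 := by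
      intro u v huv
      rw [intervalIntegral.integral_congr (g := fun _ => 0) fun t ht => hz t (huv t ht)]
      simp
    by_cases hxc : x < c
    · refine hzero p x fun t ht ht' => ?_
      have := ht.2
      have h1 : max p x < c := max_lt hc hxc
      exact absurd (ht'.1) (not_le.2 (lt_of_le_of_lt this h1))
    · have hxd : d < x := by
        by_contra h
        exact hx ⟨not_lt.1 hxc, not_lt.1 h⟩
      rw [← intervalIntegral.integral_add_adjacent_intervals (b := q)
        (hψ.continuous.intervalIntegrable _ _) (hψ.continuous.intervalIntegrable _ _),
        ← integral_vol_eq hpq, h0, zero_add]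
      refine hzero q x fun t ht ht' => ?_
      have h1 : d < min q x := lt_min hd hxd
      exact absurd ht'.2 (not_le.2 (lt_of_lt_of_le h1 ht.1))
  refine ⟨fun y => ∫ t in p..y, ψ t, ⟨?_, ?_, ?_⟩, hd'⟩
  · rw [contDiff_infty_iff_deriv, hd']
    exact ⟨fun x => (hder x).differentiableAt, hψ.1⟩
  · exact HasCompactSupport.intro (isCompact_Icc (a := c) (b := d)) hφ0
  · refine (closure_minimal (fun x hx => ?_) (isClosed_Icc (a := c) (b := d))).trans fun x hx =>
      ⟨hc.trans_le hx.1, hx.2.trans_lt hd⟩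
    by_contra h
    exact hx (hφ0 x h)

theorem vol_real_univ {p q : ℝ} (hpq : p < q) : (vol p q).real univ = q - p := by
  simp [vol, Measure.real, hpq.le]

theorem integral_vol_const {p q : ℝ} (hpq : p < q) (c : ℝ) :
    ∫ _, c ∂(vol p q) = (q - p) * c := by
  rw [integral_const, vol_real_univ hpq, smul_eq_mul]

theorem lpNorm_one_sq {p q : ℝ} (hpq : p < q) :
    lpNorm (fun _ : ℝ => (1 : ℝ)) 2 (vol p q) ^ 2 = q - p := by
  rw [lpNorm_two_sq (by fun_prop)]
  simp only [one_pow, integral_vol_const hpq, mul_one]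

/-- A test function within `(q - p) / 2` of the constant `1` in `L¹` has positive integral and can
be normalised. -/
theorem exists_isTestFun_integral_eq_one {p q : ℝ} (hpq : p < q) :
    ∃ η, IsTestFun p q η ∧ ∫ x, η x ∂(vol p q) = 1 := by
  obtain ⟨φ, hφ, h⟩ := exists_isTestFun_lpNorm_sub_le hpq ENNReal.one_ne_top le_rfl
    (memLp_const (1 : ℝ)) (ε := (q - p) / 2) (by linarith)
  have hφi : Integrable φ (vol p q) := memLp_one_iff_integrable.1 (hφ.memLp 1)
  rw [lpNorm_one_eq_integral_norm ((integrable_const _).sub hφi).1] at h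
  have h1 : |∫ x, (1 - φ x) ∂(vol p q)| ≤ (q - p) / 2 :=
    (norm_integral_le_integral_norm _).trans h
  have h2 : ∫ x, (1 - φ x) ∂(vol p q) = (q - p) - ∫ x, φ x ∂(vol p q) := by
    rw [integral_sub (integrable_const _) hφi, integral_vol_const hpq, mul_one]
  rw [h2, abs_le] at h1
  have h3 : 0 < ∫ x, φ x ∂(vol p q) := by linarith [h1.2]
  refine ⟨_, hφ.const_mul (∫ x, φ x ∂(vol p q))⁻¹, ?_⟩
  rw [integral_const_mul, inv_mul_cancel₀ h3.ne']

/-- Derivatives of test functions are dense in the mean zero functions of `L²`. -/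
theorem exists_isTestFun_lpNorm_sub_deriv_le {p q : ℝ} (hpq : p < q) {τ : ℝ → ℝ}
    (hτ : MemLp τ 2 (vol p q)) (h0 : ∫ x, τ x ∂(vol p q) = 0) {ε : ℝ} (hε : 0 < ε) :
    ∃ φ, IsTestFun p q φ ∧ lpNorm (τ - deriv φ) 2 (vol p q) ≤ ε := by
  obtain ⟨η, hη, hη1⟩ := exists_isTestFun_integral_eq_one hpq
  set L := lpNorm (fun _ : ℝ => (1 : ℝ)) 2 (vol p q)
  set E := lpNorm η 2 (vol p q)
  have hL : 0 ≤ L := lpNorm_nonneg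
  have hE : 0 ≤ E := lpNorm_nonneg
  -- The mean `m` of `ψ` is removed by subtracting `m • η`. Since `τ` has mean zero, `|m|` is at
  -- most `L` times the error, so the correction multiplies the error by at most `1 + L * E`.
  obtain ⟨ψ, hψ, h⟩ := exists_isTestFun_lpNorm_sub_le hpq (r := 2) (by norm_num) (by norm_num) hτ
    (ε := ε / (1 + L * E)) (by positivity)
  set m := ∫ x, ψ x ∂(vol p q)
  have hτi : Integrable τ (vol p q) := hτ.integrable (by norm_num)
  have hψi : Integrable ψ (vol p q) := (hψ.memLp 2).integrable (by norm_num)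
  have hηi : Integrable η (vol p q) := (hη.memLp 2).integrable (by norm_num)
  have hm : |m| ≤ lpNorm (τ - ψ) 2 (vol p q) * L := by
    have h1 := abs_integral_mul_le (hτ.sub (hψ.memLp 2)) (memLp_const (μ := vol p q) (1 : ℝ))
    simp only [Pi.sub_apply, mul_one] at h1
    rw [integral_sub hτi hψi, h0, zero_sub, abs_neg] at h1
    exact h1
  have hφ := hψ.sub (hη.const_mul m)
  obtain ⟨φ, hφ', hd⟩ := exists_isTestFun_deriv_eq hpq hφ (by
    simp only [Pi.sub_apply]
    rw [integral_sub hψi (hηi.const_mul m), integral_const_mul, hη1, mul_one, sub_self])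
  refine ⟨φ, hφ', ?_⟩
  have e : τ - deriv φ = (τ - ψ) + m • η := by
    rw [hd]; ext x; simp; ring
  rw [e]
  calc lpNorm ((τ - ψ) + m • η) 2 (vol p q)
      ≤ lpNorm (τ - ψ) 2 (vol p q) + lpNorm (m • η) 2 (vol p q) :=
        lpNorm_add_le (hτ.sub (hψ.memLp 2)) (by norm_num)
    _ = lpNorm (τ - ψ) 2 (vol p q) + |m| * E := by
        rw [lpNorm_const_smul]; simp [E]
    _ ≤ lpNorm (τ - ψ) 2 (vol p q) + lpNorm (τ - ψ) 2 (vol p q) * L * E := by gcongr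
    _ = lpNorm (τ - ψ) 2 (vol p q) * (1 + L * E) := by ring
    _ ≤ ε / (1 + L * E) * (1 + L * E) := by gcongr
    _ = ε := by field_simp

/-- Duality: the mean-zero part `T` of `τ` is an `L²` limit of derivatives of test functions, so
`‖T‖²` is nearly the pairing of `τ` with such a derivative, which gives `‖T‖² ≤ A * ‖T‖`. -/
theorem lpNorm_sub_mean_le {p q : ℝ} (hpq : p < q) {τ : ℝ → ℝ} (hτ : MemLp τ 2 (vol p q))
    {A : ℝ} (hA : 0 ≤ A)
    (H : ∀ φ, IsTestFun p q φ →
      |∫ x, τ x * deriv φ x ∂(vol p q)| ≤ A * lpNorm (deriv φ) 2 (vol p q)) :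
    lpNorm (fun x => τ x - (∫ y, τ y ∂(vol p q)) / (q - p)) 2 (vol p q) ≤ A := by
  set m := (∫ y, τ y ∂(vol p q)) / (q - p)
  set T : ℝ → ℝ := fun x => τ x - m
  have hT : MemLp T 2 (vol p q) := hτ.sub (memLp_const m)
  have hτi : Integrable τ (vol p q) := hτ.integrable (by norm_num)
  have hqp : 0 < q - p := sub_pos.2 hpq
  have hT0 : ∫ x, T x ∂(vol p q) = 0 := by
    simp only [T]
    rw [integral_sub hτi (integrable_const m), integral_vol_const hpq]
    simp only [m]
    field_simp
    ring
  set X := lpNorm T 2 (vol p q)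
  have hX : 0 ≤ X := lpNorm_nonneg
  have key : ∀ ε, 0 < ε → X ^ 2 ≤ A * X + (A + X) * ε := by
    intro ε hε
    obtain ⟨φ, hφ, h⟩ := exists_isTestFun_lpNorm_sub_deriv_le hpq hT hT0 hε
    have hφ2 := hφ.deriv.memLp 2
    have hφi : Integrable (deriv φ) (vol p q) := hφ2.integrable (by norm_num)
    have hφ0 : ∫ x, deriv φ x ∂(vol p q) = 0 := by
      rw [integral_vol_eq hpq, intervalIntegral.integral_deriv_eq_sub
        (fun x _ => hφ.differentiable x) (hφ.deriv.continuous.intervalIntegrable _ _),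
        hφ.eq_zero (x := q) (by simp), hφ.eq_zero (x := p) (by simp), sub_self]
    have h1 : ∫ x, T x * deriv φ x ∂(vol p q) = ∫ x, τ x * deriv φ x ∂(vol p q) := by
      simp only [T, sub_mul]
      rw [integral_sub (integrable_two_mul hτ hφ2) (hφi.const_mul m), integral_const_mul, hφ0,
        mul_zero, sub_zero]
    have h2 : lpNorm (deriv φ) 2 (vol p q) ≤ X + ε := by
      have e : deriv φ = T - (T - deriv φ) := by simp
      rw [e]
      exact (lpNorm_sub_le hT (by norm_num)).trans (by gcongr)
    have h3 : X ^ 2 = ∫ x, T x * deriv φ x ∂(vol p q) +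
        ∫ x, T x * (T - deriv φ) x ∂(vol p q) := by
      rw [← integral_add (integrable_two_mul hT hφ2) (integrable_two_mul hT (hT.sub hφ2)),
        lpNorm_two_sq hT.1]
      congr 1
      ext x
      simp only [Pi.sub_apply]
      ring
    have h4 := abs_integral_mul_le hT (hT.sub hφ2)
    have h5 := H φ hφ
    rw [h3, h1]
    have h6 : A * lpNorm (deriv φ) 2 (vol p q) ≤ A * (X + ε) := by gcongr
    have h7 : X * lpNorm (T - deriv φ) 2 (vol p q) ≤ X * ε := by gcongr
    linarith [le_abs_self (∫ x, T x * (T - deriv φ) x ∂(vol p q)),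
      le_abs_self (∫ x, τ x * deriv φ x ∂(vol p q))]
  have h : X ^ 2 ≤ A * X := by
    refine le_of_forall_pos_le_add fun δ hδ => ?_
    have hpos : 0 < A + X + 1 := by positivity
    refine (key (δ / (A + X + 1)) (by positivity)).trans ?_
    gcongr
    rw [mul_div_assoc', div_le_iff₀ hpos]
    nlinarith
  by_contra hlt
  rw [not_le] at hlt
  nlinarith

/-- Poincaré's inequality: `|φ|` is bounded by the `L¹` norm of `deriv φ`, hence by `√(q - p)` times
its `L²` norm. -/
theorem h1Norm_le {p q : ℝ} (hpq : p < q) {φ : ℝ → ℝ} (hφ : IsTestFun p q φ) :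
    h1Norm p q φ ≤ (q - p + 1) * lpNorm (deriv φ) 2 (vol p q) := by
  set L := lpNorm (deriv φ) 2 (vol p q)
  have hL : 0 ≤ L := lpNorm_nonneg
  have hqp : 0 < q - p := sub_pos.2 hpq
  have hφ2 := hφ.deriv.memLp 2
  have hφi : Integrable (deriv φ) (vol p q) := hφ2.integrable (by norm_num)
  set B := ∫ x, |deriv φ x| ∂(vol p q)
  have hB0 : 0 ≤ B := integral_nonneg fun x => abs_nonneg _
  have hB : B ^ 2 ≤ (q - p) * L ^ 2 := by
    have h := integral_abs_mul_le hφ2 (memLp_const (μ := vol p q) (1 : ℝ))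
    simp only [mul_one] at h
    rw [← lpNorm_one_sq hpq, ← mul_pow, mul_comm]
    exact pow_le_pow_left₀ hB0 h 2
  have hb : ∀ x ∈ Ioo p q, φ x ^ 2 ≤ B ^ 2 := by
    intro x hx
    have h1 : φ x = ∫ t in p..x, deriv φ t := by
      rw [intervalIntegral.integral_deriv_eq_sub
        (fun x _ => hφ.differentiable x) (hφ.deriv.continuous.intervalIntegrable _ _),
        hφ.eq_zero (x := p) (by simp), sub_zero]
    have h2 : |φ x| ≤ B := by
      rw [h1]
      refine (intervalIntegral.abs_integral_le_integral_abs hx.1.le).trans ?_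
      rw [intervalIntegral.integral_of_le hx.1.le, integral_Ioc_eq_integral_Ioo]
      exact setIntegral_mono_set hφi.abs (.of_forall fun x => abs_nonneg _)
        (Ioo_subset_Ioo_right hx.2.le).eventuallyLE
    rw [← sq_abs]
    exact pow_le_pow_left₀ (abs_nonneg _) h2 2
  have h3 : ∫ x, φ x ^ 2 ∂(vol p q) ≤ (q - p) * B ^ 2 := by
    rw [← integral_vol_const hpq]
    exact setIntegral_mono_on (hφ.memLp 2).integrable_sq (integrable_const _) measurableSet_Ioo hb
  rw [h1Norm, ← lpNorm_two_sq hφ2.1]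
  refine Real.sqrt_le_iff.2 ⟨by positivity, ?_⟩
  have h4 : (q - p) * B ^ 2 ≤ (q - p) * ((q - p) * L ^ 2) := by gcongr
  -- This is `(q - p) ^ 2 + 1 ≤ (q - p + 1) ^ 2`, multiplied by `L ^ 2`.
  nlinarith [mul_nonneg hqp.le (sq_nonneg L)]

theorem memLp_primitive {p q : ℝ} (hpq : p < q) {f : ℝ → ℝ} (hf : Integrable f (vol p q))
    (r : ENNReal) : MemLp (fun x => ∫ t in p..x, f t) r (vol p q) := by
  refine MemLp.of_bound ?_ (∫ x, |f x| ∂(vol p q)) ?_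
  · have h := intervalIntegral.continuousOn_primitive_interval (μ := volume) (a := p) (b := q)
      (f := f) (by rw [uIcc_of_le hpq.le]; exact (integrableOn_Icc_iff_integrableOn_Ioo (by finiteness) (by finiteness)).2 hf)
    refine (h.mono ?_).aestronglyMeasurable measurableSet_Ioo
    rw [uIcc_of_le hpq.le]
    exact Ioo_subset_Icc_self
  · refine (ae_restrict_iff' measurableSet_Ioo).2 (.of_forall fun x hx => ?_)
    refine (intervalIntegral.abs_integral_le_integral_abs hx.1.le).trans ?_
    rw [intervalIntegral.integral_of_le hx.1.le, integral_Ioc_eq_integral_Ioo]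
    exact setIntegral_mono_set hf.abs (.of_forall fun x => abs_nonneg _)
      (Ioo_subset_Ioo_right hx.2.le).eventuallyLE

/-- In one dimension strong convergence of the divergences in `H⁻¹` implies strong convergence of
the fluxes in `L²` up to additive constants. -/
theorem DivStrongConv.exists_tendsto_lpNorm {p q : ℝ} (hpq : p < q) {σ : ℕ → ℝ → ℝ}
    (h : DivStrongConv p q σ) (hσ : ∀ n, MemLp (σ n) 2 (vol p q)) :
    ∃ g : ℝ → ℝ, MemLp g 2 (vol p q) ∧ ∃ c : ℕ → ℝ,
      Tendsto (fun n => lpNorm (fun x => σ n x - g x - c n) 2 (vol p q)) atTop (𝓝 0) := by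
  obtain ⟨f₀, f₁, hf₀, hf₁, H⟩ := h
  have hf₀i : Integrable f₀ (vol p q) := hf₀.integrable (by norm_num)
  have hF := memLp_primitive hpq hf₀i 2
  -- Integrating `f₀ * φ` by parts puts the limit functional in pure divergence form, `φ ↦ ∫ g *
  -- φ'`.
  set g : ℝ → ℝ := fun x => f₁ x - ∫ t in p..x, f₀ t
  have hg : MemLp g 2 (vol p q) := hf₁.sub hF
  have hid : ∀ n φ, IsTestFun p q φ → (∫ x, σ n x * deriv φ x ∂(vol p q)) -
      ∫ x, (f₀ x * φ x + f₁ x * deriv φ x) ∂(vol p q) =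
        ∫ x, (σ n x - g x) * deriv φ x ∂(vol p q) := by
    intro n φ hφ
    have h2 := hφ.deriv.memLp 2
    have e1 := integral_primitive_mul_deriv hf₀i hφ
    have e2 : ∫ x, g x * deriv φ x ∂(vol p q) = ∫ x, f₁ x * deriv φ x ∂(vol p q) -
        ∫ x, (∫ t in p..x, f₀ t) * deriv φ x ∂(vol p q) := by
      rw [← integral_sub (integrable_two_mul hf₁ h2) (integrable_two_mul hF h2)]
      simp only [g, sub_mul]
    simp only [sub_mul]
    rw [integral_sub (integrable_two_mul (hσ n) h2) (integrable_two_mul hg h2),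
      integral_add (integrable_two_mul hf₀ (hφ.memLp 2)) (integrable_two_mul hf₁ h2), e2, e1]
    ring
  refine ⟨g, hg, fun n => (∫ y, (σ n y - g y) ∂(vol p q)) / (q - p), ?_⟩
  rw [Metric.tendsto_atTop]
  intro ε hε
  have hqp : 0 < q - p := sub_pos.2 hpq
  -- The divisor `q - p + 1` absorbs the Poincaré constant from `h1Norm_le`.
  obtain ⟨N, hN⟩ := eventually_atTop.1 (H (ε / 2 / (q - p + 1)) (by positivity))
  refine ⟨N, fun n hn => ?_⟩
  rw [Real.dist_eq, sub_zero, abs_of_nonneg lpNorm_nonneg]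
  refine lt_of_le_of_lt (lpNorm_sub_mean_le hpq ((hσ n).sub hg) (A := ε / 2) (by positivity) ?_)
    (half_lt_self hε)
  intro φ hφ
  have h1 := hN n hn φ hφ
  rw [hid n φ hφ] at h1
  refine h1.trans ?_
  refine (mul_le_mul_of_nonneg_left (h1Norm_le hpq hφ) (by positivity)).trans_eq ?_
  field_simp

/-! ### Strong convergence of fluxes and the sufficiency of the weak* conditions -/

theorem InM.abs_one_div_le {p q c C : ℝ} (hc : 0 < c) {f : ℝ → ℝ} (hf : InM p q c C f) :
    ∀ᵐ x ∂(vol p q), |1 / f x| ≤ 1 / c := by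
  filter_upwards [hf.2] with x hx
  rw [abs_of_pos (one_div_pos.2 (hc.trans_le hx.1))]
  exact one_div_le_one_div_of_le hc hx.1

theorem InM.abs_le {p q c C : ℝ} (hc : 0 < c) {f : ℝ → ℝ} (hf : InM p q c C f) :
    ∀ᵐ x ∂(vol p q), |f x| ≤ C := by
  filter_upwards [hf.2] with x hx
  rw [abs_of_pos (hc.trans_le hx.1)]
  exact hx.2

theorem InM.one_div {p q c C : ℝ} (hc : 0 < c) {f : ℝ → ℝ} (hf : InM p q c C f) :
    InM p q (1 / C) (1 / c) (fun x => 1 / f x) := by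
  refine ⟨hf.1.aemeasurable.const_div 1 |>.aestronglyMeasurable, ?_⟩
  filter_upwards [hf.2] with x hx
  exact ⟨one_div_le_one_div_of_le (hc.trans_le hx.1) hx.2, one_div_le_one_div_of_le hc hx.1⟩

/-- Bounds pass to weak* limits. -/
theorem InM.of_weakStarConv {p q c C : ℝ} {f : ℕ → ℝ → ℝ} {g : ℝ → ℝ}
    (hf : ∀ n, InM p q c C (f n)) (h : WeakStarConv p q f g) : InM p q c C g := by
  refine ⟨h.2.1.1, ?_⟩
  filter_upwards [(WeakStarConv.const p q c).ae_le h fun n => (hf n).2.mono fun x hx => hx.1,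
    h.ae_le (WeakStarConv.const p q C) fun n => (hf n).2.mono fun x hx => hx.2] with x hx hx'
    using ⟨hx, hx'⟩

theorem InM.of_weakStarConv_one_div {p q c C : ℝ} (hc : 0 < c) (hcC : c ≤ C) {f : ℕ → ℝ → ℝ}
    {g : ℝ → ℝ} (hf : ∀ n, InM p q c C (f n))
    (h : WeakStarConv p q (fun n x => 1 / f n x) (fun x => 1 / g x)) : InM p q c C g := by
  have h1 := InM.of_weakStarConv (fun n => (hf n).one_div hc) h
  have h2 := h1.one_div (one_div_pos.2 (hc.trans_le hcC))
  simpa only [one_div_one_div] using h2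

/-- An oscillating but bounded factor does no harm against a remainder that is strongly null in
`L²`; this disposes of the error terms below. -/
theorem tendsto_integral_bdd_mul_mul {p q C : ℝ} {r ρ : ℕ → ℝ → ℝ} {h : ℝ → ℝ}
    (hr : ∀ n, ∀ᵐ x ∂(vol p q), |r n x| ≤ C)
    (hh : MemLp h 2 (vol p q)) (hρ : ∀ n, MemLp (ρ n) 2 (vol p q))
    (h0 : Tendsto (fun n => lpNorm (ρ n) 2 (vol p q)) atTop (𝓝 0)) :
    Tendsto (fun n => ∫ x, r n x * (h x * ρ n x) ∂(vol p q)) atTop (𝓝 0) := by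
  have h1 : Tendsto (fun n => |C| * (lpNorm h 2 (vol p q) * lpNorm (ρ n) 2 (vol p q))) atTop
      (𝓝 0) := by
    simpa using (h0.const_mul (lpNorm h 2 (vol p q))).const_mul |C|
  refine squeeze_zero_norm (fun n => ?_) h1
  rw [Real.norm_eq_abs]
  refine (abs_integral_bdd_mul_le (C := |C|) ((hr n).mono fun x hx => hx.trans (le_abs_self C))
    (integrable_two_mul hh (hρ n))).trans ?_
  exact mul_le_mul_of_nonneg_left (integral_abs_mul_le hh (hρ n)) (abs_nonneg C)

/-- The fluxes of a test sequence converge strongly in `L²`. -/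
theorem IsTestSeq.exists_tendsto_lpNorm_flux {p q a₁ a₂ : ℝ} (hpq : p < q) (ha₁ : 0 < a₁)
    (ha : a₁ ≤ a₂) {a : ℕ → ℝ → ℝ} {aStar : ℝ → ℝ} (hM : ∀ n, InM p q a₁ a₂ (a n))
    (hconv : WeakStarConv p q (fun n x => 1 / a n x) (fun x => 1 / aStar x))
    {u du : ℕ → ℝ → ℝ} {u₀ du₀ : ℝ → ℝ} (hT : IsTestSeq p q a u du u₀ du₀) :
    ∃ σ, MemLp σ 2 (vol p q) ∧ (∀ᵐ x ∂(vol p q), σ x = aStar x * du₀ x) ∧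
      (∀ n, MemLp (fun x => a n x * du n x) 2 (vol p q)) ∧
      Tendsto (fun n => lpNorm (fun x => a n x * du n x - σ x) 2 (vol p q)) atTop (𝓝 0) := by
  have hqp : 0 < q - p := sub_pos.2 hpq
  have ha₂ : 0 < a₂ := ha₁.trans_le ha
  have hdu : ∀ n, MemLp (du n) 2 (vol p q) := hT.weak_deriv.1
  have hσ : ∀ n, MemLp (fun x => a n x * du n x) 2 (vol p q) := fun n =>
    memLp_two_bdd_mul (hM n).1 ((hM n).abs_le ha₁) (hdu n)
  obtain ⟨g, hg, c, hc⟩ := hT.strong_div.exists_tendsto_lpNorm hpq hσ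
  set ρ : ℕ → ℝ → ℝ := fun n x => a n x * du n x - g x - c n
  have hρ : ∀ n, MemLp (ρ n) 2 (vol p q) := fun n => ((hσ n).sub hg).sub (memLp_const _)
  set r : ℕ → ℝ → ℝ := fun n x => 1 / a n x
  have hrM : ∀ n, InM p q (1 / a₂) (1 / a₁) (r n) := fun n => (hM n).one_div ha₁
  have hrb : ∀ n, ∀ᵐ x ∂(vol p q), |r n x| ≤ 1 / a₁ := fun n => (hM n).abs_one_div_le ha₁
  have hrtop : ∀ n, MemLp (r n) ⊤ (vol p q) := fun n => memLp_top_of_bound (hrM n).1 _ (hrb n)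
  -- Dividing the flux `g + c n + ρ n` by `a n` expresses `du n` through the weak* convergent `r n`;
  -- all limits below come from testing this identity.
  have hae : ∀ n, ∀ᵐ x ∂(vol p q), du n x = r n x * (g x + c n + ρ n x) := fun n => by
    filter_upwards [(hM n).2] with x hx
    have : a n x ≠ 0 := (ha₁.trans_le hx.1).ne'
    simp only [r, ρ]
    field_simp
    ring
  have hexp : ∀ n h, MemLp h 2 (vol p q) → ∫ x, du n x * h x ∂(vol p q) =
      ∫ x, r n x * (g x * h x) ∂(vol p q) + c n * ∫ x, r n x * h x ∂(vol p q) +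
        ∫ x, r n x * (h x * ρ n x) ∂(vol p q) := by
    intro n h hh
    have hhi : Integrable h (vol p q) := hh.integrable (by norm_num)
    have i1 := integrable_top_mul (hrtop n) (integrable_two_mul hg hh)
    have i2 := integrable_top_mul (hrtop n) hhi
    have i3 := integrable_top_mul (hrtop n) (integrable_two_mul hh (hρ n))
    have i12 : Integrable (fun x => r n x * (g x * h x) + c n * (r n x * h x)) (vol p q) :=
      i1.add (i2.const_mul (c n))
    rw [← integral_const_mul, ← integral_add i1 (i2.const_mul (c n)), ← integral_add i12 i3]
    refine integral_congr_ae ((hae n).mono fun x hx => ?_)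
    simp only [hx]
    ring
  have hone : MemLp (fun _ : ℝ => (1 : ℝ)) 2 (vol p q) := memLp_const 1
  have hsmall : ∀ h, MemLp h 2 (vol p q) →
      Tendsto (fun n => ∫ x, r n x * (h x * ρ n x) ∂(vol p q)) atTop (𝓝 0) := fun h hh =>
    tendsto_integral_bdd_mul_mul hrb hh hρ hc
  have hlow : ∀ n, (q - p) * (1 / a₂) ≤ ∫ x, r n x * 1 ∂(vol p q) := fun n => by
    rw [← integral_vol_const hpq]
    simp only [mul_one]
    exact integral_mono_ae (integrable_const _) ((hrtop n).integrable le_top)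
      ((hrM n).2.mono fun x hx => hx.1)
  have hRlim := hconv.2.2 (fun _ => 1) (integrable_const 1)
  set R := ∫ x, 1 / aStar x * 1 ∂(vol p q)
  have hRpos : 0 < R :=
    lt_of_lt_of_le (by positivity) (ge_of_tendsto' hRlim hlow)
  -- Testing against the constant `1` gives a linear equation for `c n`, whose coefficient `∫ r n`
  -- stays above `(q - p) / a₂`.
  obtain ⟨c₀, hc₀⟩ : ∃ c₀, Tendsto c atTop (𝓝 c₀) := by
    have h1 := ((hT.weak_deriv.2.2 _ hone).sub (hconv.2.2 _ (integrable_two_mul hg hone))).sub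
      (hsmall _ hone)
    refine ⟨_, (h1.div hRlim hRpos.ne').congr fun n => ?_⟩
    have h2 : (∫ x, r n x * 1 ∂(vol p q)) ≠ 0 := (lt_of_lt_of_le (by positivity) (hlow n)).ne'
    rw [Pi.div_apply, hexp n _ hone, div_eq_iff h2]
    ring
  have hσ₀ : MemLp (fun x => g x + c₀) 2 (vol p q) := hg.add (memLp_const c₀)
  refine ⟨fun x => g x + c₀, hσ₀, ?_, hσ, ?_⟩
  · have hAM : InM p q a₁ a₂ aStar := InM.of_weakStarConv_one_div ha₁ ha hM hconv
    have hdu₀ : Integrable du₀ (vol p q) := hT.weak_deriv.2.1.integrable (by norm_num)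
    have hrσ : Integrable (fun x => 1 / aStar x * (g x + c₀)) (vol p q) :=
      integrable_top_mul hconv.2.1 (hσ₀.integrable (by norm_num))
    -- Two computations of the limit of `∫ du n * h` are compared, which identifies `du₀` as `(g +
    -- c₀) / aStar`.
    have hlim : ∀ h, MemLp h 2 (vol p q) → ∫ x, du₀ x * h x ∂(vol p q) =
        ∫ x, 1 / aStar x * (g x + c₀) * h x ∂(vol p q) := by
      intro h hh
      have hhi : Integrable h (vol p q) := hh.integrable (by norm_num)
      have i1 := integrable_top_mul hconv.2.1 (integrable_two_mul hg hh)
      have i2 := integrable_top_mul hconv.2.1 hhi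
      have l1 := ((hconv.2.2 _ (integrable_two_mul hg hh)).add
        (hc₀.mul (hconv.2.2 _ hhi))).add (hsmall h hh)
      have l2 := tendsto_nhds_unique (hT.weak_deriv.2.2 h hh) (l1.congr fun n => (hexp n h hh).symm)
      rw [l2, add_zero, ← integral_const_mul, ← integral_add i1 (i2.const_mul c₀)]
      refine integral_congr_ae (.of_forall fun x => ?_)
      simp only
      ring
    have heq : ∀ᵐ x ∂(vol p q), du₀ x = 1 / aStar x * (g x + c₀) := by
      refine hdu₀.ae_eq_of_forall_setIntegral_eq _ _ hrσ fun s hs _ => ?_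
      rw [← integral_mul_indicator_one hs, ← integral_mul_indicator_one hs]
      exact hlim _ (hone.indicator hs)
    filter_upwards [heq, hAM.2] with x hx hx'
    have : aStar x ≠ 0 := (ha₁.trans_le hx'.1).ne'
    rw [hx]
    field_simp
  · have h1 : Tendsto (fun n => lpNorm (ρ n) 2 (vol p q) +
        |c n - c₀| * lpNorm (fun _ : ℝ => (1 : ℝ)) 2 (vol p q)) atTop (𝓝 0) := by
      have h2 : Tendsto (fun n => |c n - c₀|) atTop (𝓝 0) := by
        simpa using (hc₀.sub_const c₀).abs
      simpa using hc.add (h2.mul_const _)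
    refine squeeze_zero (fun n => lpNorm_nonneg) (fun n => ?_) h1
    have e : (fun x => a n x * du n x - (g x + c₀)) =
        ρ n + (c n - c₀) • (fun _ : ℝ => (1 : ℝ)) := by
      ext x
      simp only [ρ, Pi.add_apply, Pi.smul_apply, smul_eq_mul]
      ring
    rw [e]
    refine (lpNorm_add_le (hρ n) (by norm_num)).trans_eq ?_
    rw [lpNorm_const_smul]
    simp

/-- Along any subsequence the fluxes converge strongly to `aStar * du₀`, hence weakly. -/
theorem hConverges_of_weakStarConv {p q a₁ a₂ : ℝ} (hpq : p < q) (ha₁ : 0 < a₁)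
    (ha : a₁ ≤ a₂) {a : ℕ → ℝ → ℝ} {aStar : ℝ → ℝ} (hM : ∀ n, InM p q a₁ a₂ (a n))
    (hconv : WeakStarConv p q (fun n x => 1 / a n x) (fun x => 1 / aStar x)) :
    HConverges p q a₁ a₂ a aStar := by
  have hAM : InM p q a₁ a₂ aStar := InM.of_weakStarConv_one_div ha₁ ha hM hconv
  refine ⟨hM, hAM, fun k hk u du u₀ du₀ hT => ?_⟩
  obtain ⟨σ, hσ, hσe, hσn, hlim⟩ := hT.exists_tendsto_lpNorm_flux hpq ha₁ ha (fun n => hM (k n))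
    (hconv.subseq hk)
  refine ⟨hσn, hσ.ae_eq hσe, fun h hh => ?_⟩
  have e : ∫ x, aStar x * du₀ x * h x ∂(vol p q) = ∫ x, σ x * h x ∂(vol p q) :=
    integral_congr_ae (hσe.mono fun x hx => by simp only [hx])
  rw [e]
  have h1 := tendsto_integral_bdd_mul_mul (C := 1) (r := fun _ _ => 1)
    (ρ := fun n x => a (k n) x * du n x - σ x)
    (fun n => by simp) hh (fun n => (hσn n).sub hσ) hlim
  have h2 := h1.add_const (∫ x, σ x * h x ∂(vol p q))
  rw [zero_add] at h2
  refine h2.congr fun n => ?_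
  have i1 : Integrable (fun x => 1 * (h x * (a (k n) x * du n x - σ x))) (vol p q) :=
    (integrable_two_mul hh ((hσn n).sub hσ)).const_mul 1
  have i2 := integrable_two_mul hσ hh
  rw [← integral_add i1 i2]
  refine integral_congr_ae (.of_forall fun x => ?_)
  simp only
  ring

/-- Writing the flux as `σ + ρ n` with `ρ n → 0` in `L²`, the energy density is `(b n / a n ^ 2) *
(σ + ρ n) ^ 2`. The `σ ^ 2` term converges by weak* convergence against the fixed integrable
function `σ ^ 2 * φ`; the cross and square terms vanish. -/
theorem relConverges_of_weakStarConv {p q a₁ a₂ b₁ b₂ : ℝ} (hpq : p < q) (ha₁ : 0 < a₁)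
    (ha : a₁ ≤ a₂) (hb₁ : 0 < b₁) (hb : b₁ ≤ b₂) {a b : ℕ → ℝ → ℝ} {aStar bSharp m : ℝ → ℝ}
    (hM : ∀ n, InM p q a₁ a₂ (a n)) (hB : ∀ n, InM p q b₁ b₂ (b n))
    (hconv : WeakStarConv p q (fun n x => 1 / a n x) (fun x => 1 / aStar x))
    (hm : WeakStarConv p q (fun n x => b n x / a n x ^ 2) m)
    (hbs : ∀ᵐ x ∂(vol p q), bSharp x = aStar x ^ 2 * m x) :
    RelConverges p q b₁ b₂ a b bSharp := by
  have hAM : InM p q a₁ a₂ aStar := InM.of_weakStarConv_one_div ha₁ ha hM hconv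
  have hAtop : MemLp aStar ⊤ (vol p q) := memLp_top_of_bound hAM.1 _ (hAM.abs_le ha₁)
  refine ⟨hB, ?_, fun u du u₀ du₀ hT φ hφ => ?_⟩
  · have h1 : MemLp (fun x => aStar x * (aStar x * m x)) ⊤ (vol p q) :=
      MemLp.mul (p := ⊤) (q := ⊤) (MemLp.mul (p := ⊤) (q := ⊤) hm.2.1 hAtop) hAtop
    refine h1.ae_eq (hbs.mono fun x hx => ?_)
    rw [hx]
    ring
  obtain ⟨σ, hσ, hσe, hσn, hlim⟩ := hT.exists_tendsto_lpNorm_flux hpq ha₁ ha hM hconv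
  have hφtop := hφ.memLp ⊤
  have hσ2 : Integrable (fun x => σ x * (σ x * φ x)) (vol p q) := by
    refine (integrable_top_mul hφtop (integrable_two_mul hσ hσ)).congr (.of_forall fun x => ?_)
    simp only
    ring
  have h1 := hm.2.2 _ hσ2
  have e : ∫ x, bSharp x * du₀ x ^ 2 * φ x ∂(vol p q) = ∫ x, m x * (σ x * (σ x * φ x)) ∂(vol p q) := by
    refine integral_congr_ae ?_
    filter_upwards [hσe, hbs] with x hx hx'
    rw [hx, hx']
    ring
  rw [e]
  set ρ : ℕ → ℝ → ℝ := fun n x => a n x * du n x - σ x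
  have hρ : ∀ n, MemLp (ρ n) 2 (vol p q) := fun n => (hσn n).sub hσ
  obtain ⟨C, hC0, hC⟩ := MemLp.exists_bound hφtop
  set β : ℕ → ℝ → ℝ := fun n x => b n x / a n x ^ 2
  have hβm : ∀ n, AEStronglyMeasurable (β n) (vol p q) := fun n => (hm.1 n).1
  have hb₂ : ∀ n, ∀ᵐ x ∂(vol p q), |β n x * φ x| ≤ b₂ / a₁ ^ 2 * C := fun n => by
    filter_upwards [(hB n).2, (hM n).2, hC] with x hx hx' hx''
    have hax : 0 < a n x := ha₁.trans_le hx'.1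
    have hbx : 0 < b n x := hb₁.trans_le hx.1
    rw [abs_mul]
    refine mul_le_mul ?_ hx'' (abs_nonneg _) ?_
    · rw [abs_of_pos (by positivity)]
      exact div_le_div₀ (hbx.le.trans hx.2) hx.2 (by positivity)
        (pow_le_pow_left₀ ha₁.le hx'.1 2)
    · have := hbx.le.trans hx.2
      positivity
  have hβφm : ∀ n, AEStronglyMeasurable (fun x => β n x * φ x) (vol p q) := fun n =>
    (hβm n).mul hφtop.1
  have hsq : Tendsto (fun n => ∫ x, β n x * φ x * (ρ n x * ρ n x) ∂(vol p q)) atTop (𝓝 0) := by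
    have h2 : Tendsto (fun n => b₂ / a₁ ^ 2 * C *
        (lpNorm (ρ n) 2 (vol p q) * lpNorm (ρ n) 2 (vol p q))) atTop (𝓝 0) := by
      simpa using (hlim.mul hlim).const_mul (b₂ / a₁ ^ 2 * C)
    refine squeeze_zero_norm (fun n => ?_) h2
    rw [Real.norm_eq_abs]
    refine (abs_integral_bdd_mul_le (hb₂ n) (integrable_two_mul (hρ n) (hρ n))).trans ?_
    refine mul_le_mul_of_nonneg_left (integral_abs_mul_le (hρ n) (hρ n)) ?_
    have hb₂' : 0 ≤ b₂ := hb₁.le.trans hb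
    positivity
  have hcross := tendsto_integral_bdd_mul_mul hb₂ hσ hρ hlim
  have h3 := (h1.add (hcross.const_mul 2)).add hsq
  simp only [mul_zero, add_zero] at h3
  refine h3.congr fun n => ?_
  have i1 : Integrable (fun x => β n x * (σ x * (σ x * φ x))) (vol p q) :=
    integrable_top_mul (hm.1 n) hσ2
  have i2 : Integrable (fun x => 2 * (β n x * φ x * (σ x * ρ n x))) (vol p q) :=
    (integrable_bdd_mul (hβφm n) (hb₂ n) (integrable_two_mul hσ (hρ n))).const_mul 2
  have i3 : Integrable (fun x => β n x * φ x * (ρ n x * ρ n x)) (vol p q) :=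
    integrable_bdd_mul (hβφm n) (hb₂ n) (integrable_two_mul (hρ n) (hρ n))
  have i12 : Integrable (fun x => β n x * (σ x * (σ x * φ x)) +
    2 * (β n x * φ x * (σ x * ρ n x))) (vol p q) := i1.add i2
  rw [← integral_const_mul, ← integral_add i1 i2, ← integral_add i12 i3]
  refine integral_congr_ae ((hM n).2.mono fun x hx => ?_)
  have hax : a n x ≠ 0 := (ha₁.trans_le hx.1).ne'
  simp only [ρ, β]
  field_simp
  ring

/-! ### The unit-flux test sequence and the necessity of the weak* conditions -/

theorem WeakStarConv.weakL2Conv {p q : ℝ} {f : ℕ → ℝ → ℝ} {F : ℝ → ℝ}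
    (hf : WeakStarConv p q f F) : WeakL2Conv p q f F :=
  ⟨fun n => (hf.1 n).mono_exponent le_top, hf.2.1.mono_exponent le_top,
    fun h hh => hf.2.2 h (hh.integrable (by norm_num))⟩

theorem isH1_primitive {p q : ℝ} (hpq : p < q) {f : ℝ → ℝ} (hf : MemLp f 2 (vol p q)) :
    IsH1 p q (fun x => ∫ t in p..x, f t) f :=
  ⟨memLp_primitive hpq (hf.integrable (by norm_num)) 2, hf, fun _ hφ =>
    integral_primitive_mul_deriv (hf.integrable (by norm_num)) hφ⟩

/-- The primitive at `x` is the pairing with the indicator of `Iio x`, so primitives converge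
pointwise; the uniform bound allows dominated convergence. -/
theorem WeakStarConv.weakL2Conv_primitive {p q C : ℝ} (hpq : p < q) {f : ℕ → ℝ → ℝ} {F : ℝ → ℝ}
    (hf : WeakStarConv p q f F) (hC : ∀ n, ∀ᵐ x ∂(vol p q), |f n x| ≤ C) :
    WeakL2Conv p q (fun n x => ∫ t in p..x, f n t) (fun x => ∫ t in p..x, F t) := by
  have hfi : ∀ n, Integrable (f n) (vol p q) := fun n => (hf.1 n).integrable le_top
  refine ⟨fun n => memLp_primitive hpq (hfi n) 2,
    memLp_primitive hpq (hf.2.1.integrable le_top) 2, fun h hh => ?_⟩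
  have hb : ∀ n, ∀ᵐ x ∂(vol p q), ‖(∫ t in p..x, f n t) * h x‖ ≤ (q - p) * C * |h x| := by
    intro n
    refine (ae_restrict_iff' measurableSet_Ioo).2 (.of_forall fun x hx => ?_)
    rw [norm_mul]
    refine mul_le_mul_of_nonneg_right ?_ (abs_nonneg _)
    rw [primitive_eq_setIntegral_Iio (f n) hx]
    refine (norm_integral_le_integral_norm _).trans ?_
    refine (setIntegral_le_integral (hfi n).norm (.of_forall fun _ => norm_nonneg _)).trans ?_
    rw [← integral_vol_const hpq]
    exact integral_mono_ae (hfi n).norm (integrable_const _) (hC n)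
  refine tendsto_integral_of_dominated_convergence _ (fun n => ?_)
    ((hh.integrable (by norm_num)).abs.const_mul ((q - p) * C)) hb ?_
  · exact (memLp_primitive hpq (hfi n) 2).1.mul hh.1
  · refine (ae_restrict_iff' measurableSet_Ioo).2 (.of_forall fun x hx => ?_)
    refine Tendsto.mul_const _ ?_
    simp only [primitive_eq_setIntegral_Iio _ hx]
    exact hf.tendsto_setIntegral measurableSet_Iio

/-- The sequence with constant flux `1` is a test sequence as soon as `1 / a n` converges. -/
theorem isTestSeq_one_div {p q a₁ a₂ : ℝ} (hpq : p < q) (ha₁ : 0 < a₁) {a : ℕ → ℝ → ℝ}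
    {r : ℝ → ℝ} (hM : ∀ n, InM p q a₁ a₂ (a n))
    (hconv : WeakStarConv p q (fun n x => 1 / a n x) r) :
    IsTestSeq p q a (fun n x => ∫ t in p..x, 1 / a n t) (fun n x => 1 / a n x)
      (fun x => ∫ t in p..x, r t) r where
  memH1 n := isH1_primitive hpq (hconv.weakL2Conv.1 n)
  memH1_lim := isH1_primitive hpq hconv.weakL2Conv.2.1
  weak := hconv.weakL2Conv_primitive hpq fun n => (hM n).abs_one_div_le ha₁
  weak_deriv := hconv.weakL2Conv
  strong_div := by
    refine ⟨fun _ => 0, fun _ => 1, memLp_const 0, memLp_const 1, fun δ hδ => ?_⟩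
    refine .of_forall fun n φ _ => ?_
    have e : ∫ x, a n x * (1 / a n x) * deriv φ x ∂(vol p q) =
        ∫ x, (0 * φ x + 1 * deriv φ x) ∂(vol p q) := by
      refine integral_congr_ae ((hM n).2.mono fun x hx => ?_)
      have : a n x ≠ 0 := (ha₁.trans_le hx.1).ne'
      simp only
      field_simp
      ring
    rw [e, sub_self, abs_zero]
    exact mul_nonneg hδ.le (Real.sqrt_nonneg _)

/-- Every subsequence has a further one along which `1 / a` converges weak* to some `g`. There the
unit-flux sequence is admissible, and since its flux is `1`, `H`-convergence yields `aStar * g = 1`.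
The limit does not depend on the subsequence, so the whole sequence converges. -/
theorem HConverges.weakStarConv {p q a₁ a₂ : ℝ} (hpq : p < q) (ha₁ : 0 < a₁)
    {a : ℕ → ℝ → ℝ} {aStar : ℝ → ℝ} (hH : HConverges p q a₁ a₂ a aStar) :
    WeakStarConv p q (fun n x => 1 / a n x) (fun x => 1 / aStar x) := by
  have hA := hH.2.1
  refine ⟨fun n => memLp_top_of_bound ((hH.1 n).one_div ha₁).1 _ ((hH.1 n).abs_one_div_le ha₁),
    memLp_top_of_bound (hA.one_div ha₁).1 _ (hA.abs_one_div_le ha₁), fun h hh => ?_⟩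
  refine tendsto_of_subseq_tendsto fun ns hns => ?_
  obtain ⟨k, hk, hk'⟩ := strictMono_subseq_of_tendsto_atTop hns
  obtain ⟨j, hj, g, -, hg⟩ :=
    exists_subseq_weakStarConv hpq fun n => (hH.1 (ns (k n))).one_div ha₁
  refine ⟨fun n => k (j n), ?_⟩
  have hT := isTestSeq_one_div hpq ha₁ (fun n => hH.1 (ns (k (j n)))) hg
  -- The definition's quantification over subsequences is essential here: `1 / a n` is not yet known
  -- to converge along the full sequence.
  have hflux := hH.2.2 (fun n => ns (k (j n))) (hk'.comp hj) _ _ _ _ hT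
  have hone : ∀ᵐ x ∂(vol p q), aStar x * g x = 1 := by
    refine (hflux.2.1.integrable (by norm_num)).ae_eq_of_forall_setIntegral_eq _ _
      (integrable_const 1) fun s hs _ => ?_
    have h1 := hflux.2.2 _ ((memLp_const (1 : ℝ)).indicator hs)
    simp only [integral_mul_indicator_one hs] at h1
    refine tendsto_nhds_unique h1 (tendsto_const_nhds.congr fun n => ?_)
    refine integral_congr_ae (ae_restrict_of_ae ((hH.1 (ns (k (j n)))).2.mono fun x hx => ?_))
    have : a (ns (k (j n))) x ≠ 0 := (ha₁.trans_le hx.1).ne'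
    simp only
    field_simp
  have e : ∫ x, 1 / aStar x * h x ∂(vol p q) = ∫ x, g x * h x ∂(vol p q) := by
    refine integral_congr_ae ?_
    filter_upwards [hone, hA.2] with x hx hx'
    have : aStar x ≠ 0 := (ha₁.trans_le hx'.1).ne'
    rw [eq_div_of_mul_eq this ((mul_comm _ _).trans hx)]
  rw [e]
  exact hg.2.2 h hh

theorem InM.abs_div_sq_le {p q a₁ a₂ b₁ b₂ : ℝ} (ha₁ : 0 < a₁) (hb₁ : 0 < b₁) {a b : ℝ → ℝ}
    (ha : InM p q a₁ a₂ a) (hb : InM p q b₁ b₂ b) :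
    ∀ᵐ x ∂(vol p q), |b x / a x ^ 2| ≤ b₂ / a₁ ^ 2 := by
  filter_upwards [hb.2, ha.2] with x hx hx'
  have hax : 0 < a x := ha₁.trans_le hx'.1
  have hbx : 0 < b x := hb₁.trans_le hx.1
  rw [abs_of_pos (by positivity)]
  exact div_le_div₀ (hbx.le.trans hx.2) hx.2 (by positivity) (pow_le_pow_left₀ ha₁.le hx'.1 2)

theorem InM.aestronglyMeasurable_div_sq {p q a₁ a₂ b₁ b₂ : ℝ} {a b : ℝ → ℝ}
    (ha : InM p q a₁ a₂ a) (hb : InM p q b₁ b₂ b) :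
    AEStronglyMeasurable (fun x => b x / a x ^ 2) (vol p q) :=
  (hb.1.aemeasurable.div (ha.1.aemeasurable.pow_const 2)).aestronglyMeasurable

/-- The unit-flux sequence has energy density `b n / a n ^ 2` and limit derivative `1 / aStar`.
Relative convergence gives the limit against test functions, and the uniform bound extends it to
`L¹`. -/
theorem RelConverges.weakStarConv {p q a₁ a₂ b₁ b₂ : ℝ} (hpq : p < q) (ha₁ : 0 < a₁)
    (hb₁ : 0 < b₁) {a b : ℕ → ℝ → ℝ} {aStar bSharp : ℝ → ℝ}
    (hH : HConverges p q a₁ a₂ a aStar) (hR : RelConverges p q b₁ b₂ a b bSharp) :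
    WeakStarConv p q (fun n x => b n x / a n x ^ 2) (fun x => bSharp x / aStar x ^ 2) := by
  have hconv := hH.weakStarConv hpq ha₁
  have hT := isTestSeq_one_div hpq ha₁ hH.1 hconv
  have hr : MemLp (fun x => 1 / aStar x) ⊤ (vol p q) := hconv.2.1
  refine weakStarConv_of_isTestFun hpq (C := b₂ / a₁ ^ 2)
    (fun n => (hH.1 n).aestronglyMeasurable_div_sq (hR.1 n))
    (fun n => (hH.1 n).abs_div_sq_le ha₁ hb₁ (hR.1 n)) ?_ fun φ hφ => ?_
  · have h1 : MemLp (fun x => 1 / aStar x * (1 / aStar x * bSharp x)) ⊤ (vol p q) :=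
      MemLp.mul (p := ⊤) (q := ⊤) (MemLp.mul (p := ⊤) (q := ⊤) hR.2.1 hr) hr
    refine h1.ae_eq (.of_forall fun x => ?_)
    simp only
    ring
  · have h1 := hR.2.2 _ _ _ _ hT φ hφ
    simpa only [div_pow, one_pow, mul_one_div] using h1

theorem hConverges_and_relConverges_iff {p q a₁ a₂ b₁ b₂ : ℝ} (hpq : p < q)
    (ha₁ : 0 < a₁) (ha : a₁ ≤ a₂) (hb₁ : 0 < b₁) (hb : b₁ ≤ b₂) {a b : ℕ → ℝ → ℝ}
    {aStar bSharp : ℝ → ℝ} (hM : ∀ n, InM p q a₁ a₂ (a n)) (hB : ∀ n, InM p q b₁ b₂ (b n)) :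
    (HConverges p q a₁ a₂ a aStar ∧ RelConverges p q b₁ b₂ a b bSharp) ↔
      (WeakStarConv p q (fun n x => 1 / a n x) (fun x => 1 / aStar x) ∧
        ∃ m : ℝ → ℝ, WeakStarConv p q (fun n x => b n x / a n x ^ 2) m ∧
          ∀ᵐ x ∂(vol p q), bSharp x = aStar x ^ 2 * m x) := by
  constructor
  · rintro ⟨hH, hR⟩
    refine ⟨hH.weakStarConv hpq ha₁, _, hR.weakStarConv hpq ha₁ hb₁ hH, ?_⟩
    filter_upwards [hH.2.1.2] with x hx
    have : aStar x ≠ 0 := (ha₁.trans_le hx.1).ne'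
    field_simp
  · rintro ⟨hconv, m, hm, hbs⟩
    exact ⟨hConverges_of_weakStarConv hpq ha₁ ha hM hconv,
      relConverges_of_weakStarConv hpq ha₁ ha hb₁ hb hM hB hconv hm hbs⟩

/-! ### Bounds for two-phase coefficients -/

theorem chi_eq (S : Set ℝ) (x : ℝ) : chi S x = 0 ∨ chi S x = 1 := by
  by_cases h : x ∈ S <;> simp [chi, h]

theorem inM_twoPhase {p q c₁ c₂ : ℝ} (hc : c₁ ≤ c₂) {S : Set ℝ} (hS : MeasurableSet S) :
    InM p q c₁ c₂ (twoPhase c₁ c₂ S) := by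
  have hchi : Measurable (chi S) := measurable_const.indicator hS
  refine ⟨((hchi.const_mul c₁).add ((hchi.const_sub 1).const_mul c₂)).aestronglyMeasurable,
    .of_forall fun x => ?_⟩
  rcases chi_eq S x with h | h <;> simp [twoPhase, h, hc]

theorem one_div_twoPhase (c₁ c₂ : ℝ) (S : Set ℝ) (x : ℝ) :
    1 / twoPhase c₁ c₂ S x = (1 / c₁ - 1 / c₂) * chi S x + 1 / c₂ := by
  rcases chi_eq S x with h | h <;> simp [twoPhase, h]

theorem one_div_harm (a₁ a₂ s : ℝ) : 1 / harm a₁ a₂ s = (1 / a₁ - 1 / a₂) * s + 1 / a₂ := by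
  rw [harm, one_div, inv_inv]
  ring

theorem weakStarConv_one_div_twoPhase {p q : ℝ} (a₁ a₂ : ℝ) {A : ℕ → Set ℝ} {θ : ℝ → ℝ}
    (h : WeakStarConv p q (fun n => chi (A n)) θ) :
    WeakStarConv p q (fun n x => 1 / twoPhase a₁ a₂ (A n) x) (fun x => 1 / harm a₁ a₂ (θ x)) := by
  simp only [one_div_twoPhase, one_div_harm]
  exact (h.const_mul _).add (WeakStarConv.const p q _)

/-- The weak* limit of `b / a²` when the weak* limits of `χ_A`, `χ_B`, `χ_A χ_B` are `s, t, k`. -/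
noncomputable def quotientLim (a₁ a₂ b₁ b₂ s t k : ℝ) : ℝ :=
  b₂ / a₂ ^ 2 + (b₁ - b₂) / a₂ ^ 2 * t + b₂ * (1 / a₁ ^ 2 - 1 / a₂ ^ 2) * s +
    (b₁ - b₂) * (1 / a₁ ^ 2 - 1 / a₂ ^ 2) * k

theorem twoPhase_div_sq (a₁ a₂ b₁ b₂ : ℝ) (A B : Set ℝ) (x : ℝ) :
    twoPhase b₁ b₂ B x / twoPhase a₁ a₂ A x ^ 2 =
      quotientLim a₁ a₂ b₁ b₂ (chi A x) (chi B x) (chi A x * chi B x) := by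
  rcases chi_eq A x with h | h <;> rcases chi_eq B x with h' | h' <;>
    simp [twoPhase, quotientLim, h, h'] <;> ring

/-- The coefficient of the overlap is `(b₁ - b₂) * (1 / a₁ ^ 2 - 1 / a₂ ^ 2) ≤ 0`, so more overlap
of the two first phases lowers the limit. -/
theorem quotientLim_anti {a₁ a₂ b₁ b₂ : ℝ} (ha₁ : 0 < a₁) (ha : a₁ ≤ a₂) (hb : b₁ ≤ b₂)
    (s t : ℝ) : Antitone (quotientLim a₁ a₂ b₁ b₂ s t) := by
  intro k k' hk
  have h1 : 1 / a₂ ^ 2 ≤ 1 / a₁ ^ 2 :=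
    one_div_le_one_div_of_le (by positivity) (pow_le_pow_left₀ ha₁.le ha 2)
  have h2 : (b₁ - b₂) * (1 / a₁ ^ 2 - 1 / a₂ ^ 2) ≤ 0 :=
    mul_nonpos_of_nonpos_of_nonneg (by linarith) (by linarith)
  have := mul_le_mul_of_nonpos_left hk h2
  simp only [quotientLim]
  linarith

/-- The two branches are a single expression evaluated at the largest possible overlap. -/
theorem lSharp_eq (a₁ a₂ b₁ b₂ s t : ℝ) :
    lSharp a₁ a₂ b₁ b₂ s t = harm a₁ a₂ s ^ 2 * quotientLim a₁ a₂ b₁ b₂ s t (min s t) := by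
  unfold lSharp
  split_ifs with h
  · rw [min_eq_left h, l1, quotientLim]; ring
  · rw [min_eq_right (not_le.1 h).le, l2, quotientLim]; ring

/-- Here the overlap is the smallest possible one. -/
theorem uSharp_eq (a₁ a₂ b₁ b₂ s t : ℝ) :
    uSharp a₁ a₂ b₁ b₂ s t =
      harm a₁ a₂ s ^ 2 * quotientLim a₁ a₂ b₁ b₂ s t (max 0 (s + t - 1)) := by
  unfold uSharp
  split_ifs with h
  · rw [max_eq_left (by linarith), u1, quotientLim]; ring
  · rw [max_eq_right (by linarith), u2, quotientLim]; ring

theorem weakStarConv_quotientLim {p q : ℝ} (a₁ a₂ b₁ b₂ : ℝ) {s t k : ℕ → ℝ → ℝ}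
    {S T K : ℝ → ℝ} (hs : WeakStarConv p q s S) (ht : WeakStarConv p q t T)
    (hk : WeakStarConv p q k K) :
    WeakStarConv p q (fun n x => quotientLim a₁ a₂ b₁ b₂ (s n x) (t n x) (k n x))
      (fun x => quotientLim a₁ a₂ b₁ b₂ (S x) (T x) (K x)) :=
  (((WeakStarConv.const p q _).add (ht.const_mul _)).add (hs.const_mul _)).add (hk.const_mul _)

/-- Pointwise `χ_A χ_B` lies below `χ_A` and `χ_B`, and above `0` and `χ_A + χ_B - 1`. Replacing the
product by each of these gives comparison sequences with known weak* limits, so no limit of `χ_A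
χ_B` itself is needed. -/
theorem twoPhase_bounds {p q a₁ a₂ b₁ b₂ : ℝ} (ha₁ : 0 < a₁) (ha : a₁ ≤ a₂)
    (hb : b₁ ≤ b₂) {ωA ωB : ℕ → Set ℝ} {θA θB aStar bSharp m : ℝ → ℝ}
    (hθA : WeakStarConv p q (fun n => chi (ωA n)) θA)
    (hθB : WeakStarConv p q (fun n => chi (ωB n)) θB)
    (hm : WeakStarConv p q
      (fun n x => twoPhase b₁ b₂ (ωB n) x / twoPhase a₁ a₂ (ωA n) x ^ 2) m)
    (haStar : ∀ x, aStar x = harm a₁ a₂ (θA x))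
    (hbs : ∀ᵐ x ∂(vol p q), bSharp x = aStar x ^ 2 * m x) :
    ∀ᵐ x ∂(vol p q), lSharp a₁ a₂ b₁ b₂ (θA x) (θB x) ≤ bSharp x ∧
      bSharp x ≤ uSharp a₁ a₂ b₁ b₂ (θA x) (θB x) := by
  simp only [twoPhase_div_sq] at hm
  have hanti := fun s t => quotientLim_anti ha₁ ha hb s t
  have lA := (weakStarConv_quotientLim a₁ a₂ b₁ b₂ hθA hθB hθA).ae_le hm fun n =>
    .of_forall fun x => hanti _ _ (by
      rcases chi_eq (ωA n) x with h | h <;> rcases chi_eq (ωB n) x with h' | h' <;> simp [h, h'])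
  have lB := (weakStarConv_quotientLim a₁ a₂ b₁ b₂ hθA hθB hθB).ae_le hm fun n =>
    .of_forall fun x => hanti _ _ (by
      rcases chi_eq (ωA n) x with h | h <;> rcases chi_eq (ωB n) x with h' | h' <;> simp [h, h'])
  have u0 := hm.ae_le (weakStarConv_quotientLim a₁ a₂ b₁ b₂ hθA hθB (WeakStarConv.const p q 0))
    fun n => .of_forall fun x => hanti _ _ (by
      rcases chi_eq (ωA n) x with h | h <;> rcases chi_eq (ωB n) x with h' | h' <;> simp [h, h'])
  have u1 := hm.ae_le (weakStarConv_quotientLim a₁ a₂ b₁ b₂ hθA hθB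
    ((hθA.add hθB).sub (WeakStarConv.const p q 1)))
    fun n => .of_forall fun x => hanti _ _ (by
      rcases chi_eq (ωA n) x with h | h <;> rcases chi_eq (ωB n) x with h' | h' <;> simp [h, h'])
  filter_upwards [lA, lB, u0, u1, hbs] with x h1 h2 h3 h4 h5
  rw [h5, haStar, lSharp_eq, uSharp_eq]
  constructor
  · refine mul_le_mul_of_nonneg_left ?_ (sq_nonneg _)
    rcases min_choice (θA x) (θB x) with h | h <;> rwa [h]
  · refine mul_le_mul_of_nonneg_left ?_ (sq_nonneg _)
    rcases max_choice 0 (θA x + θB x - 1) with h | h <;> rwa [h]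

/-! ### Layered sets with prescribed density -/

/-- The `j`-th cell of the uniform mesh of size `1 / (N + 1)`. -/
def cell (N : ℕ) (j : ℤ) : Set ℝ := {x | ⌊((N : ℝ) + 1) * x⌋ = j}

/-- In every cell of the mesh, an interval starting at the left end of the cell whose length is the
integral of `θ` over the part of the cell in `(p, q)`. -/
def layeredSet (p q : ℝ) (θ : ℝ → ℝ) (N : ℕ) : Set ℝ :=
  {x | x < (⌊((N : ℝ) + 1) * x⌋ : ℝ) / (N + 1) +
    ∫ y in cell N ⌊((N : ℝ) + 1) * x⌋, θ y ∂(vol p q)}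

theorem cell_eq_Ico (N : ℕ) (j : ℤ) :
    cell N j = Ico ((j : ℝ) / (N + 1)) ((j : ℝ) / (N + 1) + 1 / (N + 1)) := by
  have hN : (0 : ℝ) < N + 1 := by positivity
  ext x
  simp only [cell, mem_ofPred_eq, Int.floor_eq_iff, mem_Ico]
  rw [← add_div, div_le_iff₀ hN, lt_div_iff₀ hN, mul_comm x]

theorem measurableSet_cell (N : ℕ) (j : ℤ) : MeasurableSet (cell N j) := by
  rw [cell_eq_Ico]; exact measurableSet_Ico

theorem measurable_comp_floor (N : ℕ) (G : ℤ → ℝ) :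
    Measurable fun x : ℝ => G ⌊((N : ℝ) + 1) * x⌋ :=
  (measurable_from_top (f := G)).comp (Int.measurable_floor.comp (measurable_const_mul _))

theorem measurableSet_layeredSet (p q : ℝ) (θ : ℝ → ℝ) (N : ℕ) :
    MeasurableSet (layeredSet p q θ N) :=
  measurableSet_lt measurable_id (measurable_comp_floor N fun j =>
    (j : ℝ) / (N + 1) + ∫ y in cell N j, θ y ∂(vol p q))

/-- In each cell the sets are intervals with the same left end, so ordered densities give nested
sets. This nesting is what later controls overlaps. -/
theorem layeredSet_subset {p q : ℝ} {θ θ' : ℝ → ℝ} (hθ : Integrable θ (vol p q))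
    (hθ' : Integrable θ' (vol p q)) (h : ∀ᵐ x ∂(vol p q), θ x ≤ θ' x) (N : ℕ) :
    layeredSet p q θ N ⊆ layeredSet p q θ' N := by
  intro x hx
  have hx' : x < _ := hx
  have := integral_mono_ae (hθ.restrict (s := cell N ⌊((N : ℝ) + 1) * x⌋)) hθ'.restrict
    (ae_restrict_of_ae h)
  show x < _
  linarith

/-- Since `θ ≤ 1`, the prescribed interval fits in its cell, so its length is exactly the integral
of `θ` there. -/
theorem setIntegral_cell_chi_layeredSet {p q : ℝ} {θ : ℝ → ℝ} (hi : Integrable θ (vol p q))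
    (h01 : ∀ᵐ x ∂(vol p q), 0 ≤ θ x ∧ θ x ≤ 1) (N : ℕ) (j : ℤ) :
    ∫ x in cell N j, chi (layeredSet p q θ N) x = ∫ x in cell N j, θ x ∂(vol p q) := by
  set w := ∫ x in cell N j, θ x ∂(vol p q)
  have hN : (0 : ℝ) < N + 1 := by positivity
  have hw0 : 0 ≤ w := integral_nonneg_of_ae (ae_restrict_of_ae (h01.mono fun x hx => hx.1))
  have hw1 : w ≤ 1 / (N + 1) := by
    have h1 : w ≤ ∫ _ in cell N j, (1 : ℝ) ∂(vol p q) :=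
      integral_mono_ae hi.restrict (integrable_const 1) (ae_restrict_of_ae (h01.mono fun x hx => hx.2))
    refine h1.trans ?_
    rw [setIntegral_const, smul_eq_mul, mul_one]
    have h2 : (vol p q).real (cell N j) ≤ volume.real (cell N j) := by
      refine ENNReal.toReal_mono ?_ (Measure.restrict_apply_le _ _)
      rw [cell_eq_Ico]
      exact measure_Ico_lt_top.ne
    refine h2.trans ?_
    rw [cell_eq_Ico, Real.volume_real_Ico]
    simp [hN.le]
  have hinter : layeredSet p q θ N ∩ cell N j = Ico ((j : ℝ) / (N + 1)) ((j : ℝ) / (N + 1) + w) := by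
    ext x
    constructor
    · rintro ⟨hx, hx'⟩
      have h1 := cell_eq_Ico N j ▸ hx'
      have hxj : ⌊((N : ℝ) + 1) * x⌋ = j := hx'
      simp only [layeredSet, mem_ofPred_eq, hxj] at hx
      exact ⟨h1.1, hx⟩
    · rintro ⟨h1, h2⟩
      have hx' : x ∈ cell N j := by
        rw [cell_eq_Ico]
        exact ⟨h1, by linarith⟩
      have hxj : ⌊((N : ℝ) + 1) * x⌋ = j := hx'
      refine ⟨?_, hx'⟩
      simp only [layeredSet, mem_ofPred_eq, hxj]
      exact h2
  rw [chi, integral_indicator (measurableSet_layeredSet p q θ N),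
    Measure.restrict_restrict (measurableSet_layeredSet p q θ N), hinter, setIntegral_const,
    Real.volume_real_Ico]
  simp [hw0]

theorem abs_sub_floor_le (N : ℕ) (x : ℝ) :
    (⌊((N : ℝ) + 1) * x⌋ : ℝ) / (N + 1) ≤ x ∧
      x ≤ (⌊((N : ℝ) + 1) * x⌋ : ℝ) / (N + 1) + 1 / (N + 1) := by
  have h : x ∈ cell N ⌊((N : ℝ) + 1) * x⌋ := rfl
  rw [cell_eq_Ico] at h
  exact ⟨h.1, h.2.le⟩

/-- The characteristic functions of the layered sets converge weakly* to the density `θ`. -/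
theorem weakStarConv_chi_layeredSet {p q : ℝ} (hpq : p < q) {θ : ℝ → ℝ}
    (hθ : AEStronglyMeasurable θ (vol p q)) (h01 : ∀ᵐ x ∂(vol p q), 0 ≤ θ x ∧ θ x ≤ 1) :
    WeakStarConv p q (fun N => chi (layeredSet p q θ N)) θ := by
  have hθb : ∀ᵐ x ∂(vol p q), |θ x| ≤ 1 := h01.mono fun x hx => by
    rw [abs_of_nonneg hx.1]; exact hx.2
  have hθtop : MemLp θ ⊤ (vol p q) := memLp_top_of_bound hθ 1 hθb
  have hi : Integrable θ (vol p q) := hθtop.integrable le_top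
  have hchim : ∀ N, Measurable (chi (layeredSet p q θ N)) := fun N =>
    measurable_const.indicator (measurableSet_layeredSet p q θ N)
  have hchib : ∀ N x, 0 ≤ chi (layeredSet p q θ N) x ∧ chi (layeredSet p q θ N) x ≤ 1 :=
    fun N x => by rcases chi_eq (layeredSet p q θ N) x with h | h <;> simp [h]
  refine weakStarConv_of_isTestFun hpq (C := 1) (fun N => (hchim N).aestronglyMeasurable)
    (fun N => .of_forall fun x => by
      rw [abs_of_nonneg (hchib N x).1]; exact (hchib N x).2) hθtop fun φ hφ => ?_
  -- Cells at the ends may stick out of `(p, q)`; extension by zero lets the cell identities be used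
  -- on the whole line.
  set θ₀ : ℝ → ℝ := (Ioo p q).indicator θ
  have hθ₀i : Integrable θ₀ := (integrable_indicator_iff measurableSet_Ioo).2 hi
  have hθ₀b : ∀ᵐ x, 0 ≤ θ₀ x ∧ θ₀ x ≤ 1 := by
    filter_upwards [(ae_restrict_iff' measurableSet_Ioo).1 h01] with x hx
    by_cases hxI : x ∈ Ioo p q
    · simpa [θ₀, hxI] using hx hxI
    · simp [θ₀, hxI]
  set D : ℕ → ℝ → ℝ := fun N x => chi (layeredSet p q θ N) x - θ₀ x
  have hDm : ∀ N, AEStronglyMeasurable (D N) := fun N =>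
    (hchim N).aestronglyMeasurable.sub hθ₀i.1
  have hDb : ∀ N, ∀ᵐ x, |D N x| ≤ 1 := fun N => by
    filter_upwards [hθ₀b] with x hx
    rw [abs_le]
    constructor <;> simp only [D] <;> linarith [(hchib N x).1, (hchib N x).2, hx.1, hx.2]
  have hφi : Integrable φ := hφ.continuous.integrable_of_hasCompactSupport hφ.2.1
  have hvol : ∀ f : ℝ → ℝ, ∫ x, f x * φ x ∂(vol p q) = ∫ x, f x * φ x := fun f =>
    setIntegral_eq_integral_of_forall_compl_eq_zero fun x hx => by rw [hφ.eq_zero hx, mul_zero]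
  obtain ⟨L, hL⟩ := hφ.1.lipschitzWith_of_hasCompactSupport hφ.2.1 (by simp)
  -- The test function is frozen at the left end of each cell. `D N` integrates to zero over every
  -- cell, so only the error `φ - φM N`, of order `1 / (N + 1)`, contributes.
  set φM : ℕ → ℝ → ℝ := fun N x => φ ((⌊((N : ℝ) + 1) * x⌋ : ℝ) / (N + 1))
  have hφMm : ∀ N, Measurable (φM N) := fun N => measurable_comp_floor N fun j => φ ((j : ℝ) / (N + 1))
  -- The support extends to `q + 1` because the left end of the cell can lie in `(p, q)` while `x`
  -- is up to one mesh size beyond `q`.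
  have hbound : ∀ N x, |φ x - φM N x| ≤ (Icc p (q + 1)).indicator (fun _ => L * (1 / (N + 1) : ℝ)) x := by
    intro N x
    have hN : (0 : ℝ) < N + 1 := by positivity
    have hN1 : 1 / ((N : ℝ) + 1) ≤ 1 := by
      rw [div_le_one hN]; linarith [(Nat.cast_nonneg N : (0 : ℝ) ≤ N)]
    obtain ⟨h1, h2⟩ := abs_sub_floor_le N x
    by_cases hx : x ∈ Icc p (q + 1)
    · rw [indicator_of_mem hx]
      have h3 := hL.dist_le_mul x ((⌊((N : ℝ) + 1) * x⌋ : ℝ) / (N + 1))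
      rw [Real.dist_eq, Real.dist_eq] at h3
      refine h3.trans (mul_le_mul_of_nonneg_left ?_ L.2)
      rw [abs_le]
      constructor <;> linarith
    · rw [indicator_of_notMem hx]
      have e1 : φ x = 0 := hφ.eq_zero fun h => hx ⟨h.1.le, by linarith [h.2]⟩
      have e2 : φM N x = 0 := hφ.eq_zero fun h => hx ⟨by linarith [h.1], by linarith [h.2]⟩
      simp [e1, e2]
  have hIi : ∀ c : ℝ, Integrable ((Icc p (q + 1)).indicator fun _ => c) := fun c =>
    (integrable_indicator_iff measurableSet_Icc).2 (integrableOn_const (by simp))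
  have hdiff : ∀ N, Integrable fun x => φ x - φM N x := fun N =>
    (hIi _).mono' (hφi.1.sub (hφMm N).aestronglyMeasurable) (.of_forall (hbound N))
  have hφMi : ∀ N, Integrable (φM N) := fun N => by
    have := hφi.sub (hdiff N)
    refine this.congr (.of_forall fun x => ?_)
    simp
  have hDφM : ∀ N, ∫ x, D N x * φM N x = 0 := by
    intro N
    have hint : Integrable fun x => D N x * φM N x := integrable_bdd_mul (hDm N) (hDb N) (hφMi N)
    have hU : (⋃ j : ℤ, cell N j) = univ := by
      ext x
      simp [cell]
    have hdisj : Pairwise (Function.onFun Disjoint (cell N)) := fun i j hij =>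
      disjoint_left.2 fun x hx hx' => hij (hx.symm.trans hx')
    rw [← setIntegral_univ, ← hU, integral_iUnion (measurableSet_cell N) hdisj hint.integrableOn]
    have hz : ∀ j, ∫ x in cell N j, D N x * φM N x = 0 := by
      intro j
      have e1 : ∫ x in cell N j, D N x * φM N x = ∫ x in cell N j, D N x * φ ((j : ℝ) / (N + 1)) := by
        refine setIntegral_congr_fun (measurableSet_cell N j) fun x hx => ?_
        have hxj : ⌊((N : ℝ) + 1) * x⌋ = j := hx
        simp only [φM, hxj]
      have hfin : volume (cell N j) ≠ ⊤ := by
        rw [cell_eq_Ico]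
        exact measure_Ico_lt_top.ne
      have hci : IntegrableOn (chi (layeredSet p q θ N)) (cell N j) :=
        Measure.integrableOn_of_bounded hfin (hchim N).aestronglyMeasurable (M := 1)
          (.of_forall fun x => by
            rw [Real.norm_eq_abs, abs_of_nonneg (hchib N x).1]; exact (hchib N x).2)
      rw [e1, integral_mul_const, integral_sub hci hθ₀i.integrableOn,
        setIntegral_cell_chi_layeredSet hi h01, setIntegral_indicator measurableSet_Ioo, vol,
        Measure.restrict_restrict (measurableSet_cell N j), sub_self, zero_mul]
    simp [hz]
  have hθ₀φ : ∫ x, θ x * φ x ∂(vol p q) = ∫ x, θ₀ x * φ x := by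
    rw [← hvol]
    refine setIntegral_congr_fun measurableSet_Ioo fun x hx => ?_
    simp [θ₀, indicator_of_mem hx]
  have hkey : ∀ N, ∫ x, chi (layeredSet p q θ N) x * φ x ∂(vol p q) - ∫ x, θ x * φ x ∂(vol p q) =
      ∫ x, D N x * (φ x - φM N x) := by
    intro N
    rw [hθ₀φ, hvol]
    have i1 : Integrable fun x => chi (layeredSet p q θ N) x * φ x :=
      integrable_bdd_mul (C := 1) (hchim N).aestronglyMeasurable (.of_forall fun x => by
        rw [abs_of_nonneg (hchib N x).1]; exact (hchib N x).2) hφi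
    have i2 : Integrable fun x => θ₀ x * φ x :=
      integrable_bdd_mul (C := 1) hθ₀i.1 (hθ₀b.mono fun x hx => by
        rw [abs_of_nonneg hx.1]; exact hx.2) hφi
    have i3 : Integrable fun x => D N x * φM N x := integrable_bdd_mul (hDm N) (hDb N) (hφMi N)
    have i4 : Integrable fun x => D N x * φ x := integrable_bdd_mul (hDm N) (hDb N) hφi
    simp only [mul_sub]
    rw [integral_sub i4 i3, hDφM, sub_zero, ← integral_sub i1 i2]
    simp only [D, sub_mul]
  rw [tendsto_iff_norm_sub_tendsto_zero]
  have hlim : Tendsto (fun N : ℕ => (q + 1 - p) * (L * (1 / ((N : ℝ) + 1)))) atTop (𝓝 0) := by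
    simpa using (tendsto_one_div_add_atTop_nhds_zero_nat (𝕜 := ℝ)).const_mul (L : ℝ)
      |>.const_mul (q + 1 - p)
  refine squeeze_zero (fun N => norm_nonneg _) (fun N => ?_) hlim
  rw [hkey]
  refine (abs_integral_bdd_mul_le (hDb N) (hdiff N)).trans ?_
  rw [one_mul]
  refine (integral_mono (hdiff N).abs (hIi _) (hbound N)).trans_eq ?_
  rw [integral_indicator measurableSet_Icc, setIntegral_const, Real.volume_real_Icc,
    max_eq_left (by linarith), smul_eq_mul]

/-! ### Attainment of every value between the bounds -/

theorem harm_pos {a₁ a₂ s : ℝ} (ha₁ : 0 < a₁) (ha₂ : 0 < a₂) (h0 : 0 ≤ s) (h1 : s ≤ 1) :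
    0 < harm a₁ a₂ s := by
  unfold harm
  refine inv_pos.2 ?_
  rcases h0.eq_or_lt with h | h
  · rw [← h]; simpa using ha₂
  · have := div_pos h ha₁
    have := div_nonneg (sub_nonneg.2 h1) ha₂.le
    linarith

/-- Every value between the bounds is realised by an admissible overlap density. -/
theorem exists_overlap {a₁ a₂ b₁ b₂ : ℝ} (ha₁ : 0 < a₁) (ha : a₁ ≤ a₂) (hb : b₁ ≤ b₂) :
    ∃ κ : ℝ → ℝ → ℝ → ℝ, Measurable (fun z : ℝ × ℝ × ℝ => κ z.1 z.2.1 z.2.2) ∧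
      ∀ s t v, 0 ≤ s → s ≤ 1 → 0 ≤ t → t ≤ 1 → lSharp a₁ a₂ b₁ b₂ s t ≤ v →
        v ≤ uSharp a₁ a₂ b₁ b₂ s t → max 0 (s + t - 1) ≤ κ s t v ∧ κ s t v ≤ min s t ∧
          v = harm a₁ a₂ s ^ 2 * quotientLim a₁ a₂ b₁ b₂ s t (κ s t v) := by
  set d := (b₁ - b₂) * (1 / a₁ ^ 2 - 1 / a₂ ^ 2) with hd
  have ha₂ : 0 < a₂ := ha₁.trans_le ha
  have hq : ∀ s t k, quotientLim a₁ a₂ b₁ b₂ s t k = quotientLim a₁ a₂ b₁ b₂ s t 0 + d * k := by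
    intro s t k
    simp only [quotientLim, hd]
    ring
  have hd0 : d ≤ 0 := by
    have h1 : 1 / a₂ ^ 2 ≤ 1 / a₁ ^ 2 :=
      one_div_le_one_div_of_le (by positivity) (pow_le_pow_left₀ ha₁.le ha 2)
    exact mul_nonpos_of_nonpos_of_nonneg (by linarith) (by linarith)
  -- If the slope vanishes (`a₁ = a₂` or `b₁ = b₂`), the bounds coincide and any admissible overlap
  -- works.
  by_cases hdz : d = 0
  · refine ⟨fun s t _ => min s t, by fun_prop, fun s t v hs hs1 ht ht1 hl hu => ?_⟩
    refine ⟨max_le (le_min hs ht) (le_min (by linarith) (by linarith)), le_rfl, ?_⟩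
    rw [lSharp_eq] at hl
    rw [uSharp_eq] at hu
    rw [hq, hdz, zero_mul, add_zero] at hl hu ⊢
    exact le_antisymm hu hl
  · have hneg : d < 0 := lt_of_le_of_ne hd0 hdz
    -- Otherwise the affine equation for the overlap is solved; as the slope is negative, the upper
    -- bound on `v` becomes the lower bound on `k`, and conversely.
    refine ⟨fun s t v => (v / harm a₁ a₂ s ^ 2 - quotientLim a₁ a₂ b₁ b₂ s t 0) / d, ?_,
      fun s t v hs hs1 ht ht1 hl hu => ?_⟩
    · simp only [harm, quotientLim]
      fun_prop
    · have hh : 0 < harm a₁ a₂ s ^ 2 := by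
        have := harm_pos ha₁ ha₂ hs hs1
        positivity
      set k := (v / harm a₁ a₂ s ^ 2 - quotientLim a₁ a₂ b₁ b₂ s t 0) / d with hk
      have hv : v = harm a₁ a₂ s ^ 2 * quotientLim a₁ a₂ b₁ b₂ s t k := by
        rw [hq, hk, mul_div_cancel₀ _ hdz, add_sub_cancel, mul_div_cancel₀ _ hh.ne']
      rw [lSharp_eq] at hl
      rw [uSharp_eq] at hu
      rw [hv, hq s t k, hq s t (min s t), mul_le_mul_iff_right₀ hh, add_le_add_iff_left] at hl
      rw [hv, hq s t k, hq s t (max _ _), mul_le_mul_iff_right₀ hh, add_le_add_iff_left] at hu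
      exact ⟨(mul_le_mul_left_of_neg hneg).1 hu, (mul_le_mul_left_of_neg hneg).1 hl, hv⟩

theorem chi_diff_of_subset {S T : Set ℝ} (h : S ⊆ T) (x : ℝ) :
    chi (T \ S) x = chi T x - chi S x := by
  by_cases hS : x ∈ S
  · simp [chi, hS, h hS]
  · by_cases hT : x ∈ T <;> simp [chi, hS, hT]

theorem chi_mul_chi_diff {R S T : Set ℝ} (h : S ⊆ R) (h' : R ⊆ T) (x : ℝ) :
    chi R x * chi (T \ S) x = chi R x - chi S x := by
  by_cases hR : x ∈ R
  · by_cases hS : x ∈ S <;> simp [chi, hR, hS, h' hR]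
  · have hS : x ∉ S := fun hx => hR (h hx)
    simp [chi, hR, hS]

/-- Take nested layered sets `S ⊆ A ⊆ T` of densities `θA - k`, `θA`, `θA - k + θB`, and `B = T \
S`. Then `B` has density `θB` and `A ∩ B = A \ S` has density `k`. -/
theorem exists_twoPhase_sets {p q a₁ a₂ b₁ b₂ : ℝ} (hpq : p < q) (ha₁ : 0 < a₁) (ha : a₁ ≤ a₂)
    (hb₁ : 0 < b₁) (hb : b₁ ≤ b₂) {θA θB v : ℝ → ℝ}
    (hA : AEStronglyMeasurable θA (vol p q)) (hB : AEStronglyMeasurable θB (vol p q))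
    (hv : AEStronglyMeasurable v (vol p q))
    (hA01 : ∀ᵐ x ∂(vol p q), 0 ≤ θA x ∧ θA x ≤ 1) (hB01 : ∀ᵐ x ∂(vol p q), 0 ≤ θB x ∧ θB x ≤ 1)
    (hvb : ∀ᵐ x ∂(vol p q), lSharp a₁ a₂ b₁ b₂ (θA x) (θB x) ≤ v x ∧
      v x ≤ uSharp a₁ a₂ b₁ b₂ (θA x) (θB x)) :
    ∃ ωA ωB : ℕ → Set ℝ,
      (∀ n, MeasurableSet (ωA n)) ∧ (∀ n, MeasurableSet (ωB n)) ∧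
      WeakStarConv p q (fun n => chi (ωA n)) θA ∧ WeakStarConv p q (fun n => chi (ωB n)) θB ∧
      HConverges p q a₁ a₂ (fun n => twoPhase a₁ a₂ (ωA n)) (fun x => harm a₁ a₂ (θA x)) ∧
      RelConverges p q b₁ b₂ (fun n => twoPhase a₁ a₂ (ωA n))
        (fun n => twoPhase b₁ b₂ (ωB n)) v := by
  obtain ⟨κ, hκm, hκ⟩ := exists_overlap ha₁ ha hb (b₁ := b₁) (b₂ := b₂)
  set k : ℝ → ℝ := fun x => κ (θA x) (θB x) (v x)
  have hkm : AEStronglyMeasurable k (vol p q) :=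
    (hκm.comp_aemeasurable (hA.aemeasurable.prodMk
      (hB.aemeasurable.prodMk hv.aemeasurable))).aestronglyMeasurable
  have hk : ∀ᵐ x ∂(vol p q), 0 ≤ k x ∧ θA x + θB x - 1 ≤ k x ∧ k x ≤ θA x ∧ k x ≤ θB x ∧
      v x = harm a₁ a₂ (θA x) ^ 2 * quotientLim a₁ a₂ b₁ b₂ (θA x) (θB x) (k x) := by
    filter_upwards [hA01, hB01, hvb] with x h1 h2 h3
    obtain ⟨h4, h5, h6⟩ := hκ _ _ _ h1.1 h1.2 h2.1 h2.2 h3.1 h3.2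
    exact ⟨(le_max_left _ _).trans h4, (le_max_right _ _).trans h4, h5.trans (min_le_left _ _),
      h5.trans (min_le_right _ _), h6⟩
  -- The overlap bounds are what is required: `k ≤ θA` gives `0 ≤ θ₁`, `0 ≤ k ≤ θB` gives `θ₁ ≤ θA ≤
  -- θ₂`, and `θA + θB - 1 ≤ k` gives `θ₂ ≤ 1`.
  set θ₁ : ℝ → ℝ := fun x => θA x - k x
  set θ₂ : ℝ → ℝ := fun x => θA x - k x + θB x
  have h1m : AEStronglyMeasurable θ₁ (vol p q) := hA.sub hkm
  have h2m : AEStronglyMeasurable θ₂ (vol p q) := h1m.add hB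
  have h1b : ∀ᵐ x ∂(vol p q), 0 ≤ θ₁ x ∧ θ₁ x ≤ 1 := by
    filter_upwards [hk, hA01] with x hx hx'
    constructor <;> simp only [θ₁] <;> linarith [hx.1, hx.2.2.1, hx'.2]
  have h2b : ∀ᵐ x ∂(vol p q), 0 ≤ θ₂ x ∧ θ₂ x ≤ 1 := by
    filter_upwards [hk, hB01] with x hx hx'
    constructor <;> simp only [θ₂] <;> linarith [hx.2.1, hx.2.2.1, hx'.1]
  have cA := weakStarConv_chi_layeredSet hpq hA hA01
  have c1 := weakStarConv_chi_layeredSet hpq h1m h1b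
  have c2 := weakStarConv_chi_layeredSet hpq h2m h2b
  have iA := cA.2.1.integrable le_top
  have i1 := c1.2.1.integrable le_top
  have i2 := c2.2.1.integrable le_top
  have s1 : ∀ n, layeredSet p q θ₁ n ⊆ layeredSet p q θA n :=
    layeredSet_subset i1 iA (hk.mono fun x hx => by simp only [θ₁]; linarith [hx.1])
  have s2 : ∀ n, layeredSet p q θA n ⊆ layeredSet p q θ₂ n :=
    layeredSet_subset iA i2 (hk.mono fun x hx => by simp only [θ₂]; linarith [hx.2.2.2.1])
  have mA : ∀ n, MeasurableSet (layeredSet p q θA n) := measurableSet_layeredSet p q θA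
  have mB : ∀ n, MeasurableSet (layeredSet p q θ₂ n \ layeredSet p q θ₁ n) := fun n =>
    (measurableSet_layeredSet p q θ₂ n).diff (measurableSet_layeredSet p q θ₁ n)
  have cB : WeakStarConv p q (fun n => chi (layeredSet p q θ₂ n \ layeredSet p q θ₁ n)) θB :=
    (c2.sub c1).congr (fun n => .of_forall fun x =>
      (chi_diff_of_subset ((s1 n).trans (s2 n)) x).symm)
      (.of_forall fun x => by simp only [θ₁, θ₂]; ring)
  have cAB : WeakStarConv p q (fun n x => chi (layeredSet p q θA n) x *
      chi (layeredSet p q θ₂ n \ layeredSet p q θ₁ n) x) k :=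
    (cA.sub c1).congr (fun n => .of_forall fun x => (chi_mul_chi_diff (s1 n) (s2 n) x).symm)
      (.of_forall fun x => by simp only [θ₁]; ring)
  have hM : ∀ n, InM p q a₁ a₂ (twoPhase a₁ a₂ (layeredSet p q θA n)) := fun n =>
    inM_twoPhase ha (mA n)
  have hconv := weakStarConv_one_div_twoPhase a₁ a₂ cA
  refine ⟨fun n => layeredSet p q θA n, fun n => layeredSet p q θ₂ n \ layeredSet p q θ₁ n,
    mA, mB, cA, cB, hConverges_of_weakStarConv hpq ha₁ ha hM hconv, ?_⟩
  refine relConverges_of_weakStarConv hpq ha₁ ha hb₁ hb hM (fun n => inM_twoPhase hb (mB n)) hconv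
    (m := fun x => quotientLim a₁ a₂ b₁ b₂ (θA x) (θB x) (k x)) ?_
    (hk.mono fun x hx => hx.2.2.2.2)
  simp only [twoPhase_div_sq]
  exact weakStarConv_quotientLim a₁ a₂ b₁ b₂ cA cB cAB

end RelHom

/-! ### Assembly of the three statements -/

theorem mainTheorem8 (p q a₁ a₂ b₁ b₂ : ℝ) (hpq : p < q)
    (ha₁ : 0 < a₁) (ha : a₁ ≤ a₂) (hb₁ : 0 < b₁) (hb : b₁ ≤ b₂) :
    -- the relative limit in one dimension
    (∀ (a b : ℕ → ℝ → ℝ) (aStar bSharp : ℝ → ℝ),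
      (∀ n, RelHom.InM p q a₁ a₂ (a n)) → (∀ n, RelHom.InM p q b₁ b₂ (b n)) →
      ((RelHom.HConverges p q a₁ a₂ a aStar ∧ RelHom.RelConverges p q b₁ b₂ a b bSharp) ↔
        (RelHom.WeakStarConv p q (fun n x => 1 / a n x) (fun x => 1 / aStar x) ∧
          ∃ m : ℝ → ℝ, RelHom.WeakStarConv p q (fun n x => b n x / a n x ^ 2) m ∧
            ∀ᵐ x ∂(RelHom.vol p q), bSharp x = aStar x ^ 2 * m x))) ∧
    -- the bounds for two-phase media
    (∀ (ωA ωB : ℕ → Set ℝ) (θA θB : ℝ → ℝ),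
      (∀ n, MeasurableSet (ωA n)) → (∀ n, MeasurableSet (ωB n)) →
      RelHom.WeakStarConv p q (fun n => RelHom.chi (ωA n)) θA →
      RelHom.WeakStarConv p q (fun n => RelHom.chi (ωB n)) θB →
      RelHom.HConverges p q a₁ a₂ (fun n => RelHom.twoPhase a₁ a₂ (ωA n))
          (fun x => RelHom.harm a₁ a₂ (θA x)) ∧
        ∀ bSharp : ℝ → ℝ,
          RelHom.RelConverges p q b₁ b₂ (fun n => RelHom.twoPhase a₁ a₂ (ωA n))
            (fun n => RelHom.twoPhase b₁ b₂ (ωB n)) bSharp →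
          ∀ᵐ x ∂(RelHom.vol p q),
            RelHom.lSharp a₁ a₂ b₁ b₂ (θA x) (θB x) ≤ bSharp x ∧
              bSharp x ≤ RelHom.uSharp a₁ a₂ b₁ b₂ (θA x) (θB x)) ∧
    -- every value between the bounds is attained
    (∀ θA θB v : ℝ → ℝ,
      AEStronglyMeasurable θA (RelHom.vol p q) → AEStronglyMeasurable θB (RelHom.vol p q) →
      AEStronglyMeasurable v (RelHom.vol p q) →
      (∀ᵐ x ∂(RelHom.vol p q), 0 ≤ θA x ∧ θA x ≤ 1) →
      (∀ᵐ x ∂(RelHom.vol p q), 0 ≤ θB x ∧ θB x ≤ 1) →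
      (∀ᵐ x ∂(RelHom.vol p q), RelHom.lSharp a₁ a₂ b₁ b₂ (θA x) (θB x) ≤ v x ∧
        v x ≤ RelHom.uSharp a₁ a₂ b₁ b₂ (θA x) (θB x)) →
      ∃ ωA ωB : ℕ → Set ℝ,
        (∀ n, MeasurableSet (ωA n)) ∧ (∀ n, MeasurableSet (ωB n)) ∧
        RelHom.WeakStarConv p q (fun n => RelHom.chi (ωA n)) θA ∧
        RelHom.WeakStarConv p q (fun n => RelHom.chi (ωB n)) θB ∧
        RelHom.HConverges p q a₁ a₂ (fun n => RelHom.twoPhase a₁ a₂ (ωA n))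
          (fun x => RelHom.harm a₁ a₂ (θA x)) ∧
        RelHom.RelConverges p q b₁ b₂ (fun n => RelHom.twoPhase a₁ a₂ (ωA n))
          (fun n => RelHom.twoPhase b₁ b₂ (ωB n)) v) := by
  refine ⟨fun a b aStar bSharp hM hB =>
    RelHom.hConverges_and_relConverges_iff hpq ha₁ ha hb₁ hb hM hB, ?_, ?_⟩
  · intro ωA ωB θA θB mA mB cA cB
    have hM : ∀ n, RelHom.InM p q a₁ a₂ (RelHom.twoPhase a₁ a₂ (ωA n)) := fun n =>
      RelHom.inM_twoPhase ha (mA n)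
    have hB : ∀ n, RelHom.InM p q b₁ b₂ (RelHom.twoPhase b₁ b₂ (ωB n)) := fun n =>
      RelHom.inM_twoPhase hb (mB n)
    have hH := RelHom.hConverges_of_weakStarConv hpq ha₁ ha hM
      (RelHom.weakStarConv_one_div_twoPhase a₁ a₂ cA)
    refine ⟨hH, fun bSharp hR => ?_⟩
    obtain ⟨-, m, hm, hbs⟩ :=
      (RelHom.hConverges_and_relConverges_iff hpq ha₁ ha hb₁ hb hM hB).1 ⟨hH, hR⟩
    exact RelHom.twoPhase_bounds ha₁ ha hb cA cB hm (fun _ => rfl) hbs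
  · intro θA θB v hA hB hv hA01 hB01 hvb
    exact RelHom.exists_twoPhase_sets hpq ha₁ ha hb₁ hb hA hB hv hA01 hB01 hvb
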